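/- Let $\mathcal{A}$ be a finite central arrangement of hyperplanes in $\mathbb{R}^d$ (all hyperplanes pass through the origin), let $n=\#\mathcal{A}$, let $\cap\mathcal{A}=\bigcap_{H\in\mathcal{A}}H$ (with $\cap\emptyset=\mathbb{R}^d$), and let $r=\operatorname{rank}\mathcal{A}=\operatorname{codim}(\cap\mathcal{A})$. The chambers of $\mathcal{A}$ are the connected components of $\mathbb{R}^d\setminus\bigcup_{H\in\mathcal{A}}H$; for chambers $C,C'$ let $S(C,C')$ be the set of $H\in\mathcal{A}$ separating $C$ and $C'$. The tope graph $\mathcal{T}(\mathcal{A})$ has the chambers as vertices, $C,C'$ being adjacent if $\#S(C,C')=1$; let $d$ be its graph metric. Magnitude. Let $\mathrm{Mag}(\mathcal{A},q)\in\mathbb{Q}(q)$ be the sum of all entries of the inverse of the matrix $[q^{d(C,C')}]_{C,C'}$, and let the interior magnitude be $\mathrm{Mag}^\circ(\mathcal{A})=\mathrm{Mag}^\circ(\mathcal{A},q)=(-1)^{r}\,\mathrm{Mag}(\mathcal{A},q^{-1})$. Magnitude homology. Let $MC_{k,\ell}(\mathcal{A})$ be the free abelian group on the tuples $\vec{x}=(x_0,\dots,x_k)$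 of chambers with $x_{i-1}\ne x_{i}$ for $1\le i\le k$ and $\sum_{i=1}^{k} d(x_{i-1},x_i)=\ell$, with boundary $\partial=\sum_{i=1}^{k-1}(-1)^{i-1}\partial_i$, where $\partial_i$ deletes $x_i$ if $d(x_{i-1},x_{i+1})=d(x_{i-1},x_i)+d(x_i,x_{i+1})$ and is $0$ otherwise. Its homology is the magnitude homology $MH_{k,\ell}(\mathcal{A})$, and $\chi_\ell(\mathcal{A})=\sum_k(-1)^k\operatorname{rank}MH_{k,\ell}(\mathcal{A})$. Put $S(\vec{x})=\bigcup_{i=1}^{k}S(x_{i-1},x_i)$. The interior magnitude complex $MC^\circ_{*,\ell}(\mathcal{A})$ is the subcomplex of $MC_{*,\ell}(\mathcal{A})$ given by the direct sum, over all $\mathcal{B}\subseteq\mathcal{A}$ with $\cap\mathcal{B}=\cap\mathcal{A}$, of the subgroups generated by the $\vec{x}$ with $S(\vec{x})=\mathcal{B}$. Its homology is the interior magnitude homology $MH^\circ_{k,\ell}(\mathcal{A})$, and $\chi^\circ_\ell(\mathcal{A})=\sum_k(-1)^k\operatorname{rank}MH^\circ_{k,\ell}(\mathcal{A})$. Then the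 power series expansion of the interior magnitude at $q=0$ is $$\mathrm{Mag}^\circ(\mathcal{A})=\sum_{\ell=0}^{\infty}\chi^\circ_\ell(\mathcal{A})\,q^\ell .$$ Moreover, $\chi^\circ_{\ell+n}(\mathcal{A})=(-1)^r\chi_\ell(\mathcal{A})$ for all $\ell\ge 0$, and $\chi^\circ_\ell(\mathcal{A})=0$ for $0\le\ell<n$. -/

import Mathlib

/-! ### Magnitude and magnitude homology of a finite graph -/

namespace GraphMagnitude

section

variable {V : Type*}

open Classical in
/-- The zeta matrix `[q ^ d(x, y)]` of a graph over `ℚ(q)`, where `q ^ ∞ = 0`. -/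
noncomputable def zetaMatrix (G : SimpleGraph V) : Matrix V V (RatFunc ℚ) :=
  Matrix.of fun x y => if G.edist x y = ⊤ then 0 else RatFunc.X ^ G.dist x y

open Classical in
/-- The magnitude of a finite graph: the sum of all entries of the inverse of the zeta matrix.
(The zeta matrix is always invertible over `ℚ(q)`: it is the identity matrix at `q = 0`.) -/
noncomputable def mag [Fintype V] (G : SimpleGraph V) : RatFunc ℚ :=
  ∑ x, ∑ y, (zetaMatrix G)⁻¹ x y

/-- The free abelian group on all `(k + 1)`-tuples `(x_0, …, x_k)` of vertices. -/
abbrev Chain (V : Type*) (k : ℕ) : Type _ := (Fin (k + 1) → V) →₀ ℤ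

/-- The length `d(x_0, x_1) + ⋯ + d(x_{k-1}, x_k)` of a tuple. -/
noncomputable def length (G : SimpleGraph V) {k : ℕ} (x : Fin (k + 1) → V) : ℕ∞ :=
  ∑ i : Fin k, G.edist (x i.castSucc) (x i.succ)

/-- The proper `k`-chains of length `ℓ`: consecutive vertices are distinct. -/
def properChains (G : SimpleGraph V) (k ℓ : ℕ) : Set (Fin (k + 1) → V) :=
  {x | (∀ i : Fin k, x i.castSucc ≠ x i.succ) ∧ length G x = ℓ}

/-- The magnitude chain group `MC_{k,ℓ}(G)`. -/
noncomputable def magChains (G : SimpleGraph V) (ℓ k : ℕ) : Submodule ℤ (Chain V k) :=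
  Finsupp.supported ℤ ℤ (properChains G k ℓ)

/-- For a `(k + 1)`-chain `x`, the interior vertex `x_{i+1}` (with `0 ≤ i < k`) is smooth. -/
def IsSmooth (G : SimpleGraph V) {k : ℕ} (x : Fin (k + 2) → V) (i : Fin k) : Prop :=
  G.edist (x i.castSucc.castSucc) (x i.succ.succ) =
    G.edist (x i.castSucc.castSucc) (x i.succ.castSucc) +
      G.edist (x i.succ.castSucc) (x i.succ.succ)

open Classical in
/-- The boundary of `(k + 1)`-chains: the alternating sum over the interior vertices `x_{i+1}`,
with sign `(-1) ^ i`, of the chain with `x_{i+1}` deleted if `x_{i+1}` is smooth, and of `0`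
otherwise. -/
noncomputable def boundary (G : SimpleGraph V) (k : ℕ) : Chain V (k + 1) →ₗ[ℤ] Chain V k :=
  Finsupp.linearCombination ℤ fun x : Fin (k + 2) → V =>
    ∑ i : Fin k, if IsSmooth G x i then
      Finsupp.single (fun j => x (i.succ.castSucc.succAbove j)) ((-1 : ℤ) ^ (i : ℕ)) else 0

/-- The `k`-cycles of a graded subgroup `C` of the tuples. -/
noncomputable def cycles (G : SimpleGraph V) (C : ∀ k, Submodule ℤ (Chain V k)) :
    ∀ k, Submodule ℤ (Chain V k)
  | 0 => C 0
  | k + 1 => C (k + 1) ⊓ LinearMap.ker (boundary G k)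

/-- The `k`-boundaries of a graded subgroup `C` of the tuples. -/
noncomputable def boundaries (G : SimpleGraph V) (C : ∀ k, Submodule ℤ (Chain V k)) (k : ℕ) :
    Submodule ℤ (Chain V k) :=
  (C (k + 1)).map (boundary G k)

/-- The homology `cycles / boundaries` of a subcomplex `C`. (For a subcomplex all boundaries are
cycles, and `submoduleOf` only regards them as a subgroup of the group of cycles.) -/
abbrev Homology (G : SimpleGraph V) (C : ∀ k, Submodule ℤ (Chain V k)) (k : ℕ) : Type _ :=
  cycles G C k ⧸ (boundaries G C k).submoduleOf (cycles G C k)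

/-- The Betti number: the rank of the abelian group `H_k(C)`. -/
noncomputable def betti (G : SimpleGraph V) (C : ∀ k, Submodule ℤ (Chain V k)) (k : ℕ) : ℕ :=
  Module.finrank ℤ (Homology G C k)

/-- The Euler characteristic `∑_k (-1)^k rank H_k(C)`. -/
noncomputable def eulerChar (G : SimpleGraph V) (C : ∀ k, Submodule ℤ (Chain V k)) : ℤ :=
  ∑ᶠ k : ℕ, (-1 : ℤ) ^ k * (betti G C k : ℤ)

end

end GraphMagnitude

/-! ### Real central hyperplane arrangements -/

/-- A (finite, real, central) hyperplane arrangement in `ℝ^d`. -/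
structure Arrangement (d : ℕ) where
  /-- The hyperplanes of the arrangement. -/
  hyperplanes : Finset (Submodule ℝ (EuclideanSpace ℝ (Fin d)))
  /-- Each of them is the kernel of a nonzero linear form. -/
  exists_form : ∀ H ∈ hyperplanes, ∃ α : Module.Dual ℝ (EuclideanSpace ℝ (Fin d)),
    α ≠ 0 ∧ LinearMap.ker α = H

namespace Arrangement

section

variable {d : ℕ}

/-- The number of hyperplanes. -/
def card (A : Arrangement d) : ℕ := A.hyperplanes.card

/-- The center, i.e. the intersection of all hyperplanes (`ℝ^d` for the empty arrangement). -/
noncomputable def center (A : Arrangement d) : Submodule ℝ (EuclideanSpace ℝ (Fin d)) :=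
  sInf (A.hyperplanes : Set (Submodule ℝ (EuclideanSpace ℝ (Fin d))))

/-- The rank, i.e. the codimension of the center. -/
noncomputable def rank (A : Arrangement d) : ℕ :=
  Module.finrank ℝ (EuclideanSpace ℝ (Fin d) ⧸ A.center)

/-- The complement of the union of the hyperplanes. -/
def complement (A : Arrangement d) : Set (EuclideanSpace ℝ (Fin d)) :=
  {x | ∀ H ∈ A.hyperplanes, x ∉ H}

/-- The chambers: the connected components of the complement. -/
def Chamber (A : Arrangement d) : Type :=
  {C : Set (EuclideanSpace ℝ (Fin d)) //
    ∃ x ∈ A.complement, C = connectedComponentIn A.complement x}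

/-- There are only finitely many chambers. -/
instance (A : Arrangement d) : Finite A.Chamber := by
  classical
  choose α hα using fun H : A.hyperplanes => A.exists_form H.1 H.2
  choose p hp using fun C : A.Chamber => C.2
  refine Finite.of_injective
    (fun (C : A.Chamber) (H : A.hyperplanes) => decide (0 < α H (p C))) ?_
  intro C D h
  have key : segment ℝ (p C) (p D) ⊆ A.complement := by
    rintro z ⟨a, b, ha, hb, hab, rfl⟩ H hH hz
    have h1 : α ⟨H, hH⟩ (p C) ≠ 0 := fun h0 => (hp C).1 H hH (by
      have := (hα ⟨H, hH⟩).2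
      rw [← show LinearMap.ker (α ⟨H, hH⟩) = H from this]; exact h0)
    have h2 : α ⟨H, hH⟩ (p D) ≠ 0 := fun h0 => (hp D).1 H hH (by
      have := (hα ⟨H, hH⟩).2
      rw [← show LinearMap.ker (α ⟨H, hH⟩) = H from this]; exact h0)
    have h3 : α ⟨H, hH⟩ (a • p C + b • p D) = 0 := by
      have := (hα ⟨H, hH⟩).2
      rw [← show LinearMap.ker (α ⟨H, hH⟩) = H from this] at hz; exact hz
    have h4 : (0 < α ⟨H, hH⟩ (p C)) ↔ (0 < α ⟨H, hH⟩ (p D)) := by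
      simpa using congrFun h ⟨H, hH⟩
    simp only [map_add, map_smul, smul_eq_mul] at h3
    have hb' : b = 1 - a := by linarith
    subst hb'
    rcases lt_or_gt_of_ne h1 with h1 | h1
    · have h2' : α ⟨H, hH⟩ (p D) < 0 :=
        lt_of_le_of_ne (not_lt.1 fun h => absurd (h4.2 h) (not_lt.2 h1.le)) h2
      rcases ha.eq_or_lt with rfl | ha
      · simp at h3; exact h2 h3
      · nlinarith [mul_neg_of_pos_of_neg ha h1, mul_nonpos_of_nonneg_of_nonpos hb h2'.le]
    · have h2' := h4.1 h1
      rcases ha.eq_or_lt with rfl | ha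
      · simp at h3; exact h2 h3
      · nlinarith [mul_pos ha h1, mul_nonneg hb h2'.le]
  have hmem : p D ∈ connectedComponentIn A.complement (p C) :=
    (convex_segment (p C) (p D)).isPreconnected.subset_connectedComponentIn
      (left_mem_segment ℝ _ _) key (right_mem_segment ℝ _ _)
  apply Subtype.ext
  rw [(hp C).2, (hp D).2]
  exact connectedComponentIn_eq hmem

noncomputable instance (A : Arrangement d) : Fintype A.Chamber := Fintype.ofFinite _

/-- `H` separates `C` and `D`: these lie strictly on opposite sides of `H`. -/
def Separates (H : Submodule ℝ (EuclideanSpace ℝ (Fin d)))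
    (C D : Set (EuclideanSpace ℝ (Fin d))) : Prop :=
  ∃ α : Module.Dual ℝ (EuclideanSpace ℝ (Fin d)), LinearMap.ker α = H ∧
    (∀ x ∈ C, 0 < α x) ∧ ∀ y ∈ D, α y < 0

theorem Separates.symm {H : Submodule ℝ (EuclideanSpace ℝ (Fin d))}
    {C D : Set (EuclideanSpace ℝ (Fin d))} (h : Separates H C D) : Separates H D C := by
  obtain ⟨α, h1, h2, h3⟩ := h
  refine ⟨-α, ?_, fun x hx => ?_, fun y hy => ?_⟩
  · rw [← h1]; ext x; simp
  · simpa using h3 x hx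
  · simpa using h2 y hy

/-- The set `S(C, D)` of hyperplanes of `A` that separate the chambers `C` and `D`. -/
def sep (A : Arrangement d) (C D : A.Chamber) :
    Set (Submodule ℝ (EuclideanSpace ℝ (Fin d))) :=
  {H | H ∈ A.hyperplanes ∧ Separates H C.1 D.1}

theorem sep_comm (A : Arrangement d) (C D : A.Chamber) : A.sep C D = A.sep D C :=
  Set.ext fun _ => and_congr_right fun _ => ⟨Separates.symm, Separates.symm⟩

theorem sep_self (A : Arrangement d) (C : A.Chamber) : A.sep C C = ∅ := by
  refine Set.eq_empty_of_forall_notMem ?_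
  rintro H ⟨-, α, -, h1, h2⟩
  obtain ⟨x, hx, hC⟩ := C.2
  have hxC : x ∈ C.1 := by rw [hC]; exact mem_connectedComponentIn hx
  exact lt_asymm (h1 x hxC) (h2 x hxC)

/-- The tope graph: two chambers are adjacent if exactly one hyperplane separates them. -/
def topeGraph (A : Arrangement d) : SimpleGraph A.Chamber where
  Adj C D := ∃ H, A.sep C D = {H}
  symm := ⟨fun C D ⟨H, h⟩ => ⟨H, by rw [A.sep_comm, h]⟩⟩
  loopless := ⟨fun C ⟨H, h⟩ => by
    rw [A.sep_self] at h; exact (Set.singleton_nonempty H).ne_empty h.symm⟩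

/-- The magnitude `Mag(A, q)` of an arrangement: the magnitude of its tope graph. -/
noncomputable def mag (A : Arrangement d) : RatFunc ℚ := GraphMagnitude.mag A.topeGraph

/-- The interior magnitude `Mag°(A, q) = (-1)^{rank A} Mag(A, q⁻¹)`. -/
noncomputable def interiorMag (A : Arrangement d) : RatFunc ℚ :=
  (-1) ^ A.rank * A.mag.eval RatFunc.C (RatFunc.X)⁻¹

/-- The length `ℓ` magnitude Euler characteristic `χ_ℓ(A) = ∑_k (-1)^k rank MH_{k,ℓ}(A)`. -/
noncomputable def magEulerChar (A : Arrangement d) (ℓ : ℕ) : ℤ :=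
  GraphMagnitude.eulerChar A.topeGraph (GraphMagnitude.magChains A.topeGraph ℓ)

/-- The set `S(x)` of hyperplanes crossed by the chain of chambers `x`. -/
def crossed (A : Arrangement d) {k : ℕ} (x : Fin (k + 1) → A.Chamber) :
    Set (Submodule ℝ (EuclideanSpace ℝ (Fin d))) :=
  ⋃ i : Fin k, A.sep (x i.castSucc) (x i.succ)

/-- The `B`-supported magnitude chain group `MC_{k,ℓ}(A; B)`, generated by the proper chains `x`
of length `ℓ` with `S(x) = B`. -/
noncomputable def supportedChains (A : Arrangement d)
    (B : Set (Submodule ℝ (EuclideanSpace ℝ (Fin d)))) (ℓ k : ℕ) :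
    Submodule ℤ (GraphMagnitude.Chain A.Chamber k) :=
  Finsupp.supported ℤ ℤ {x | x ∈ GraphMagnitude.properChains A.topeGraph k ℓ ∧ A.crossed x = B}

/-- The `X`-supported magnitude complex `MC_{*,ℓ}(A; X)`: the sum of the groups `MC_{*,ℓ}(A; B)`
over all `B ⊆ A` with `⋂ B = X`. (This sum inside the chain group is direct, because the groups
`MC_{*,ℓ}(A; B)` are spanned by pairwise disjoint sets of basis elements.) -/
noncomputable def flatChains (A : Arrangement d)
    (X : Submodule ℝ (EuclideanSpace ℝ (Fin d))) (ℓ k : ℕ) :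
    Submodule ℤ (GraphMagnitude.Chain A.Chamber k) :=
  ⨆ B ∈ {B : Set (Submodule ℝ (EuclideanSpace ℝ (Fin d))) |
    B ⊆ (A.hyperplanes : Set (Submodule ℝ (EuclideanSpace ℝ (Fin d)))) ∧ sInf B = X},
    A.supportedChains B ℓ k

/-- The interior magnitude complex `MC°_{*,ℓ}(A) = MC_{*,ℓ}(A; ⋂ A)`. -/
noncomputable def interiorChains (A : Arrangement d) (ℓ k : ℕ) :
    Submodule ℤ (GraphMagnitude.Chain A.Chamber k) :=
  A.flatChains A.center ℓ k

/-- The length `ℓ` interior magnitude Euler characteristic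
`χ°_ℓ(A) = ∑_k (-1)^k rank MH°_{k,ℓ}(A)`. -/
noncomputable def interiorEulerChar (A : Arrangement d) (ℓ : ℕ) : ℤ :=
  GraphMagnitude.eulerChar A.topeGraph (A.interiorChains ℓ)

end

end Arrangement

/-! Chambers are identified with the nowhere-zero sign vectors of points (covectors), and graph
distance with the number of sign differences. For a set `T` of hyperplanes let `pathSeries s T` be
the signed generating series of the proper paths of chambers that cross exactly `T`. By
Euler–Poincaré the series of `χ` sums these over all `T`, and that of `χ°` over the `T` with the
same intersection as the whole arrangement. Expanding the inverse zeta matrix as a Neumann series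
shows that the first sum is also the magnitude.

The geometric input is the Euler characteristic of an open convex region cut into faces
(`sum_faces_eq`). It implies that a signed combination of weightings of stars of faces solves, up to
sign, the weighting equation of the restricted matrix `zeta s B` (`sum_weighting_eq_sum_covector`).
Möbius inversion in `B` expresses `pathSeries s T` through the faces whose zero set is exactly `T`.
If `T` cuts out the center, the only such face is the center itself, and then `T` is everything.
Hence the series of `χ°` is `(-1)^r q^n` times the magnitude (`sum_pathSeries_spanning`), which
gives the shift and the vanishing.

The antipodal map satisfies `d(C, -E) = n - d(C, E)`, so `Mag(q⁻¹) = q^n Mag(q)` (`invertX_mag`),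
and the interior magnitude is the same product. -/

namespace GraphMagnitude

/-! ### Smooth deletions, `∂² = 0` and the Euler–Poincaré formula. -/

section

variable {V : Type*}

/-- Deletion of the interior vertex `x_{i+1}` of a tuple. -/
def deleteVertex {k : ℕ} (x : Fin (k + 2) → V) (i : Fin k) : Fin (k + 1) → V :=
  fun j => x (i.succ.castSucc.succAbove j)

theorem deleteVertex_of_le {k : ℕ} (x : Fin (k + 2) → V) (i : Fin k) (m : Fin (k + 1))
    (h : m.val ≤ i.val) : deleteVertex x i m = x m.castSucc := by
  unfold deleteVertex
  rw [Fin.succAbove_of_castSucc_lt]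
  simp only [Fin.lt_def, Fin.val_castSucc, Fin.val_succ]
  omega

theorem deleteVertex_of_lt {k : ℕ} (x : Fin (k + 2) → V) (i : Fin k) (m : Fin (k + 1))
    (h : i.val < m.val) : deleteVertex x i m = x m.succ := by
  unfold deleteVertex
  rw [Fin.succAbove_of_le_castSucc]
  simp only [Fin.le_def, Fin.val_castSucc, Fin.val_succ]
  omega

open Classical in
theorem boundary_single (G : SimpleGraph V) {k : ℕ} (x : Fin (k + 2) → V) (c : ℤ) :
    boundary G k (Finsupp.single x c) =
      ∑ i : Fin k, if IsSmooth G x i then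
        Finsupp.single (deleteVertex x i) (c * (-1 : ℤ) ^ (i : ℕ)) else 0 := by
  rw [boundary, Finsupp.linearCombination_single, Finset.smul_sum]
  refine Finset.sum_congr rfl fun i _ => ?_
  split_ifs
  · rw [Finsupp.smul_single, smul_eq_mul]; rfl
  · simp

theorem deleteVertex_deleteVertex {k : ℕ} (x : Fin (k + 3) → V) (i j : Fin k)
    (h : i.val ≤ j.val) :
    deleteVertex (deleteVertex x i.castSucc) j = deleteVertex (deleteVertex x j.succ) i := by
  funext m
  by_cases h1 : m.val ≤ i.val
  · rw [deleteVertex_of_le _ _ _ (h1.trans h), deleteVertex_of_le _ _ _ (by simpa using h1),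
      deleteVertex_of_le _ _ _ h1, deleteVertex_of_le _ _ _ (by simp; omega)]
  · push Not at h1
    by_cases h2 : m.val ≤ j.val
    · rw [deleteVertex_of_le _ _ _ h2, deleteVertex_of_lt _ _ _ (by simpa using h1),
        deleteVertex_of_lt _ _ _ h1, deleteVertex_of_le _ _ _ (by simp; omega)]
      rfl
    · push Not at h2
      rw [deleteVertex_of_lt _ _ _ h2, deleteVertex_of_lt _ _ _ (by simp; omega),
        deleteVertex_of_lt _ _ _ h1, deleteVertex_of_lt _ _ _ (by simp; omega)]

/-- If the two deleted vertices are consecutive, each side says that the outer distance is the sum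
of the three steps between. Otherwise neither deletion touches the triple tested by the other.
Finite distances are needed to cancel in the triangle inequalities. -/
theorem isSmooth_deleteVertex (G : SimpleGraph V) (hG : ∀ a b, G.edist a b ≠ ⊤) {k : ℕ}
    (x : Fin (k + 3) → V) (i j : Fin k) (h : i.val ≤ j.val) :
    (IsSmooth G x i.castSucc ∧ IsSmooth G (deleteVertex x i.castSucc) j) ↔
      (IsSmooth G x j.succ ∧ IsSmooth G (deleteVertex x j.succ) i) := by
  have tri := fun a b c => G.edist_triangle (u := a) (v := b) (w := c)
  unfold IsSmooth
  rcases h.eq_or_lt with h | h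
  · obtain rfl : i = j := Fin.ext h
    rw [deleteVertex_of_le _ i.castSucc i.castSucc.castSucc (by simp),
      deleteVertex_of_lt _ i.castSucc i.succ.castSucc (by simp),
      deleteVertex_of_lt _ i.castSucc i.succ.succ (by simp),
      deleteVertex_of_le _ i.succ i.castSucc.castSucc (by simp),
      deleteVertex_of_le _ i.succ i.succ.castSucc (by simp),
      deleteVertex_of_lt _ i.succ i.succ.succ (by simp)]
    set a := x i.castSucc.castSucc.castSucc
    set b := x i.castSucc.succ.castSucc with hb
    set c := x i.castSucc.succ.succ with hc
    set e := x i.succ.succ.succ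
    have hb' : x i.succ.castSucc.castSucc = b := rfl
    have hc' : x i.succ.succ.castSucc = c := rfl
    have hc'' : x i.succ.castSucc.succ = c := rfl
    rw [hb', hc', hc'']
    have h1 := tri a b c
    have h2 := tri a c e
    have h3 := tri b c e
    have h4 := tri a b e
    revert h1 h2 h3 h4
    lift G.edist a b to ℕ using hG _ _ with ab
    lift G.edist a c to ℕ using hG _ _ with ac
    lift G.edist a e to ℕ using hG _ _ with ae
    lift G.edist b c to ℕ using hG _ _ with bc
    lift G.edist b e to ℕ using hG _ _ with be
    lift G.edist c e to ℕ using hG _ _ with ce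
    norm_cast
    omega
  · rw [deleteVertex_of_lt _ i.castSucc j.castSucc.castSucc (by simp; omega),
      deleteVertex_of_lt _ i.castSucc j.succ.castSucc (by simp; omega),
      deleteVertex_of_lt _ i.castSucc j.succ.succ (by simp; omega),
      deleteVertex_of_le _ j.succ i.castSucc.castSucc (by simp; omega),
      deleteVertex_of_le _ j.succ i.succ.castSucc (by simp; omega),
      deleteVertex_of_le _ j.succ i.succ.succ (by simp; omega)]
    exact and_comm

theorem boundary_comp_boundary (G : SimpleGraph V) (hG : ∀ a b, G.edist a b ≠ ⊤) (k : ℕ) :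
    boundary G k ∘ₗ boundary G (k + 1) = 0 := by
  classical
  refine Finsupp.lhom_ext fun x c => ?_
  rw [LinearMap.comp_apply, boundary_single, map_sum, LinearMap.zero_apply]
  have key : ∀ i : Fin (k + 1), boundary G k (if IsSmooth G x i then
      Finsupp.single (deleteVertex x i) (c * (-1 : ℤ) ^ (i : ℕ)) else 0) =
      ∑ j : Fin k, if IsSmooth G x i ∧ IsSmooth G (deleteVertex x i) j then
        Finsupp.single (deleteVertex (deleteVertex x i) j)
          (c * (-1 : ℤ) ^ (i : ℕ) * (-1 : ℤ) ^ (j : ℕ)) else 0 := by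
    intro i
    by_cases h : IsSmooth G x i
    · simp only [h, if_true, true_and, boundary_single]
    · simp [h]
  rw [Finset.sum_congr rfl fun i _ => key i, ← Fintype.sum_prod_type']
  have pair : ∀ i j : Fin k, i.val ≤ j.val →
      (if IsSmooth G x i.castSucc ∧ IsSmooth G (deleteVertex x i.castSucc) j then
        Finsupp.single (deleteVertex (deleteVertex x i.castSucc) j)
          (c * (-1 : ℤ) ^ (i.castSucc : ℕ) * (-1 : ℤ) ^ (j : ℕ)) else 0) +
      (if IsSmooth G x j.succ ∧ IsSmooth G (deleteVertex x j.succ) i then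
        Finsupp.single (deleteVertex (deleteVertex x j.succ) i)
          (c * (-1 : ℤ) ^ (j.succ : ℕ) * (-1 : ℤ) ^ (i : ℕ)) else 0) = 0 := by
    intro i j h
    rw [deleteVertex_deleteVertex x i j h]
    simp only [isSmooth_deleteVertex G hG x i j h]
    split_ifs
    · rw [← Finsupp.single_add]
      refine Finsupp.single_eq_zero.2 ?_
      simp only [Fin.val_castSucc, Fin.val_succ]
      ring
    · simp
  -- The term `(i, j)` with `i ≤ j` cancels against `(j + 1, i)`: same two vertices, opposite order,
  -- opposite sign.
  refine Finset.sum_involution (fun p _ => if h : p.1.val ≤ p.2.val then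
      (p.2.succ, ⟨p.1.val, by omega⟩) else
      (p.2.castSucc, ⟨p.1.val - 1, by omega⟩)) ?_ ?_ (fun _ _ => Finset.mem_univ _) ?_
  · rintro ⟨i, j⟩ -
    by_cases h : i.val ≤ j.val
    · rw [dif_pos h]
      exact pair ⟨i.val, by omega⟩ j h
    · rw [dif_neg h, add_comm]
      have := pair j ⟨i.val - 1, by omega⟩ (by simp; omega)
      have e : (⟨i.val - 1, by omega⟩ : Fin k).succ = i := by
        ext; simp; omega
      rw [e] at this
      exact this
  · rintro ⟨i, j⟩ - -
    by_cases h : i.val ≤ j.val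
    · rw [dif_pos h]
      intro h'
      have := congrArg (fun p => (Prod.fst p).val) h'
      simp at this
      omega
    · rw [dif_neg h]
      intro h'
      have := congrArg (fun p => (Prod.fst p).val) h'
      simp at this
      omega
  · rintro ⟨i, j⟩ -
    by_cases h : i.val ≤ j.val
    · have h2 : ¬ (j.val + 1 ≤ i.val) := by omega
      simp [h, h2]
    · have h2 : j.val ≤ i.val - 1 := by omega
      simp only [h, dif_neg, not_false_eq_true, Fin.val_castSucc, h2, dif_pos]
      refine Prod.ext (Fin.ext ?_) rfl
      simp
      omega

theorem deleteVertex_castSucc_and_succ {k : ℕ} (x : Fin (k + 2) → V) {i m : Fin k} (h : m ≠ i) :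
    deleteVertex x i m.castSucc = x (i.castSucc.succAbove m).castSucc ∧
      deleteVertex x i m.succ = x (i.castSucc.succAbove m).succ := by
  rcases h.lt_or_gt with hm | hm <;> rw [Fin.lt_def] at hm
  · rw [deleteVertex_of_le x i m.castSucc (by simp; omega),
      deleteVertex_of_le x i m.succ (by simp; omega),
      Fin.succAbove_of_castSucc_lt i.castSucc m hm]
    exact ⟨rfl, rfl⟩
  · rw [deleteVertex_of_lt x i m.castSucc (by simp; omega),
      deleteVertex_of_lt x i m.succ (by simp; omega),
      Fin.succAbove_of_le_castSucc i.castSucc m hm.le]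
    exact ⟨rfl, rfl⟩

theorem length_deleteVertex (G : SimpleGraph V) {k : ℕ} (x : Fin (k + 2) → V) (i : Fin k)
    (h : IsSmooth G x i) : length G (deleteVertex x i) = length G x := by
  unfold length
  rw [Fin.sum_univ_succAbove _ i.castSucc, ← Finset.add_sum_erase _ _ (Finset.mem_univ i),
    ← Finset.add_sum_erase Finset.univ _ (Finset.mem_univ i), ← add_assoc]
  congr 1
  · rw [deleteVertex_of_le x i i.castSucc (by simp), deleteVertex_of_lt x i i.succ (by simp)]
    rw [Fin.succAbove_of_le_castSucc _ _ le_rfl]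
    exact h
  · refine Finset.sum_congr rfl fun m hm => ?_
    have := deleteVertex_castSucc_and_succ x (Finset.ne_of_mem_erase hm)
    rw [this.1, this.2]

theorem deleteVertex_mem_properChains (G : SimpleGraph V)
    {k l : ℕ} (x : Fin (k + 2) → V) (hx : x ∈ properChains G (k + 1) l) (i : Fin k)
    (h : IsSmooth G x i) : deleteVertex x i ∈ properChains G k l := by
  refine ⟨fun m => ?_, (length_deleteVertex G x i h).trans hx.2⟩
  rcases lt_trichotomy m.val i.val with hm | hm | hm
  · rw [deleteVertex_of_le x i m.castSucc (by simp; omega),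
      deleteVertex_of_le x i m.succ (by simp; omega)]
    exact hx.1 m.castSucc
  · obtain rfl : m = i := Fin.ext hm
    rw [deleteVertex_of_le x m m.castSucc (by simp), deleteVertex_of_lt x m m.succ (by simp)]
    -- If the neighbours of a smooth vertex coincided, both of its steps would have length zero,
    -- against properness.
    intro h0
    have h1 := hx.1 m.castSucc
    unfold IsSmooth at h
    rw [h0, SimpleGraph.edist_self] at h
    have h2 := (add_eq_zero.1 h.symm).2
    have h3 := (add_eq_zero.1 h.symm).1
    rw [SimpleGraph.edist_eq_zero_iff] at h2
    rw [← h0] at h2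
    exact h1 h2.symm
  · rw [deleteVertex_of_lt x i m.castSucc (by simp; omega),
      deleteVertex_of_lt x i m.succ (by simp; omega)]
    exact hx.1 m.succ

theorem le_of_mem_properChains (G : SimpleGraph V) {k l : ℕ} (x : Fin (k + 1) → V)
    (hx : x ∈ properChains G k l) : k ≤ l := by
  have h : ∑ _i : Fin k, (1 : ℕ∞) ≤ length G x := by
    refine Finset.sum_le_sum fun i _ => ?_
    rw [Order.one_le_iff_ne_zero, Ne, SimpleGraph.edist_eq_zero_iff]
    exact hx.1 i
  rw [hx.2] at h
  simpa using h

/-- A boundary map preserves supports as soon as all smooth deletions do. -/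
theorem map_boundary_supported_le (G : SimpleGraph V) {k : ℕ} (s : Set (Fin (k + 2) → V))
    (t : Set (Fin (k + 1) → V))
    (h : ∀ x ∈ s, ∀ i : Fin k, IsSmooth G x i → deleteVertex x i ∈ t) :
    (Finsupp.supported ℤ ℤ s).map (boundary G k) ≤ Finsupp.supported ℤ ℤ t := by
  classical
  rw [Finsupp.supported_eq_span_single, Submodule.map_span_le]
  rintro _ ⟨x, hx, rfl⟩
  rw [boundary_single]
  refine Submodule.sum_mem _ fun i _ => ?_
  split_ifs with hi
  · exact Finsupp.single_mem_supported ℤ _ (h x hx i hi)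
  · exact Submodule.zero_mem _

theorem finrank_supported {X : Type*} [Finite X] (s : Set X) :
    Module.finrank ℤ (Finsupp.supported ℤ ℤ s) = s.ncard := by
  classical
  have := Fintype.ofFinite s
  rw [(Finsupp.supportedEquivFinsupp s).finrank_eq, Module.finrank_finsupp_self,
    ← Nat.card_eq_fintype_card, Nat.card_coe_set_eq]

theorem finrank_map_add_finrank_inf_ker {M N : Type*} [AddCommGroup M] [AddCommGroup N]
    [Module.Finite ℤ M] [Module.Free ℤ M] (f : M →ₗ[ℤ] N) (p : Submodule ℤ M) :
    Module.finrank ℤ (p.map f) + Module.finrank ℤ (p ⊓ LinearMap.ker f : Submodule ℤ M) =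
      Module.finrank ℤ p := by
  have h := Submodule.finrank_quotient_add_finrank (LinearMap.ker (f.domRestrict p))
  rw [(f.domRestrict p).quotKerEquivRange.finrank_eq] at h
  rw [← h, LinearMap.range_domRestrict]
  congr 1
  have : (LinearMap.ker (f.domRestrict p)) = (p ⊓ LinearMap.ker f).submoduleOf p := by
    ext x
    simp [Submodule.submoduleOf]
  rw [this, (Submodule.submoduleOfEquivOfLe inf_le_left).finrank_eq]

/-- The Euler–Poincaré formula for finite subcomplexes of the tuples. -/
theorem eulerChar_eq_sum_finrank [Finite V] (G : SimpleGraph V) (hG : ∀ a b, G.edist a b ≠ ⊤)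
    (C : ∀ k, Submodule ℤ (Chain V k)) (hC : ∀ k, (C (k + 1)).map (boundary G k) ≤ C k)
    (K : ℕ) (hK : ∀ k, K < k → C k = ⊥) :
    eulerChar G C = ∑ k ∈ Finset.range (K + 1), (-1 : ℤ) ^ k * (Module.finrank ℤ (C k) : ℤ) := by
  have hB : ∀ k, boundaries G C k ≤ cycles G C k := by
    rintro (_ | k)
    · exact hC 0
    · refine le_inf (hC _) ?_
      rintro _ ⟨y, -, rfl⟩
      exact LinearMap.congr_fun (boundary_comp_boundary G hG k) y
  have hbetti : ∀ k, (betti G C k : ℤ) =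
      Module.finrank ℤ (cycles G C k) - Module.finrank ℤ (boundaries G C k) := by
    intro k
    have := Submodule.finrank_quotient_add_finrank
      ((boundaries G C k).submoduleOf (cycles G C k))
    rw [(Submodule.submoduleOfEquivOfLe (hB k)).finrank_eq] at this
    unfold betti
    rw [← this]
    push_cast
    ring
  have hbot : ∀ k, K < k → cycles G C k = ⊥ := by
    rintro (_ | k) hk
    · omega
    · change C (k + 1) ⊓ _ = ⊥
      rw [hK _ hk, bot_inf_eq]
  have hsupp : Function.support (fun k : ℕ => (-1 : ℤ) ^ k * (betti G C k : ℤ)) ⊆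
      (Finset.range (K + 1) : Set ℕ) := by
    intro k hk
    by_contra h
    simp only [Finset.coe_range, Set.mem_Iio, not_lt] at h
    refine hk ?_
    have hc := hbot k (by omega)
    have hb : boundaries G C k = ⊥ := le_bot_iff.1 (hc ▸ hB k)
    have h0 : ∀ p : Submodule ℤ (Chain V k), p = ⊥ → Module.finrank ℤ p = 0 := by
      rintro _ rfl
      exact finrank_bot ℤ _
    simp only [hbetti, h0 _ hc, h0 _ hb]
    simp
  rw [eulerChar, finsum_eq_sum_of_support_subset _ hsupp]
  have hrec : ∀ k, (Module.finrank ℤ (C (k + 1)) : ℤ) =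
      Module.finrank ℤ (boundaries G C k) + Module.finrank ℤ (cycles G C (k + 1)) := by
    intro k
    rw [← finrank_map_add_finrank_inf_ker (boundary G k) (C (k + 1))]
    push_cast
    rfl
  -- The ranks of the boundary groups telescope, leaving only the one in top degree; it vanishes at
  -- `K`.
  have tele : ∀ n, ∑ k ∈ Finset.range (n + 1), (-1 : ℤ) ^ k * (betti G C k : ℤ) =
      ∑ k ∈ Finset.range (n + 1), (-1 : ℤ) ^ k * (Module.finrank ℤ (C k) : ℤ) -
        (-1 : ℤ) ^ n * Module.finrank ℤ (boundaries G C n) := by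
    intro n
    induction n with
    | zero =>
      simp only [zero_add, Finset.sum_range_one, hbetti]
      simp [cycles]
      rfl
    | succ n ih =>
      rw [Finset.sum_range_succ, ih, Finset.sum_range_succ _ (n + 1), hbetti, hrec]
      ring
  have hlast : boundaries G C K = ⊥ := by
    unfold boundaries
    rw [hK _ (Nat.lt_succ_self K), Submodule.map_bot]
  rw [tele, hlast, finrank_bot]
  simp

end

end GraphMagnitude

/-! ### The Euler characteristic of an open convex set, counted by faces. -/

namespace SignVector

section

variable {V : Type*} [AddCommGroup V] [Module ℝ V]

/-- The common kernel of the forms vanishing on a face. -/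
def flat {ι : Type*} (α : ι → Module.Dual ℝ V) (σ : ι → SignType) : Submodule ℝ V :=
  ⨅ i ∈ {i | σ i = 0}, LinearMap.ker (α i)

theorem mem_flat {ι : Type*} (α : ι → Module.Dual ℝ V) (σ : ι → SignType) (v : V) :
    v ∈ flat α σ ↔ ∀ i, σ i = 0 → α i v = 0 := by
  simp [flat, Submodule.mem_iInf]

theorem flat_cons {n : ℕ} (α : Fin (n + 1) → Module.Dual ℝ V) (ε : SignType)
    (τ : Fin n → SignType) :
    (ε = 0 → flat α (Fin.cons ε τ : Fin (n + 1) → SignType) =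
      flat (fun i => α i.succ) τ ⊓ LinearMap.ker (α 0)) ∧
    (ε ≠ 0 → flat α (Fin.cons ε τ : Fin (n + 1) → SignType) = flat (fun i => α i.succ) τ) := by
  constructor <;> intro h <;> ext v <;> simp [mem_flat, Fin.forall_fin_succ, h, and_comm]

theorem finrank_inf_ker [FiniteDimensional ℝ V] (L : Submodule ℝ V) (f : Module.Dual ℝ V) (u : V)
    (hu : u ∈ L) (hf : f u ≠ 0) :
    Module.finrank ℝ (L ⊓ LinearMap.ker f : Submodule ℝ V) + 1 = Module.finrank ℝ L := by
  have h := LinearMap.finrank_range_add_finrank_ker (f.domRestrict L)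
  have hr : LinearMap.range (f.domRestrict L) = ⊤ := by
    refine LinearMap.range_eq_top.2 (LinearMap.surjective ?_)
    intro h0
    exact hf (LinearMap.congr_fun h0 ⟨u, hu⟩)
  have hk : (LinearMap.ker (f.domRestrict L)) = (L ⊓ LinearMap.ker f).submoduleOf L := by
    ext x
    simp [Submodule.submoduleOf]
  rw [hr, finrank_top, Module.finrank_self, hk,
    (Submodule.submoduleOfEquivOfLe inf_le_left).finrank_eq] at h
  omega

theorem eventually_sign_add_mul (a b : ℝ) (h : a = 0 → b = 0) :
    ∀ᶠ t in nhds (0 : ℝ), SignType.sign (a + t * b) = SignType.sign a := by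
  by_cases ha : a = 0
  · simp [ha, h ha]
  have hc : Filter.Tendsto (fun t : ℝ => a + t * b) (nhds 0) (nhds a) := by
    have : Continuous fun t : ℝ => a + t * b := by fun_prop
    simpa using this.tendsto 0
  rcases lt_or_gt_of_ne ha with ha | ha
  · filter_upwards [hc.eventually (gt_mem_nhds ha)] with t ht
    rw [sign_neg ht, sign_neg ha]
  · filter_upwards [hc.eventually (lt_mem_nhds ha)] with t ht
    rw [sign_pos ht, sign_pos ha]

open Classical in
/-- The Euler characteristic of a nonempty open convex set, computed from the faces of an
arrangement. -/
theorem sum_faces_eq [FiniteDimensional ℝ V] (R : Set V) (hne : R.Nonempty) (hconv : Convex ℝ R)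
    (hopen : ∀ v ∈ R, ∀ u, ∀ᶠ t in nhds (0 : ℝ), v + t • u ∈ R) :
    ∀ (n : ℕ) (α : Fin n → Module.Dual ℝ V),
      ∑ σ : Fin n → SignType, (if ∃ v ∈ R, ∀ i, SignType.sign (α i v) = σ i then
        (-1 : ℤ) ^ Module.finrank ℝ (flat α σ) else 0) = (-1) ^ Module.finrank ℝ V := by
  intro n
  induction n with
  | zero =>
    intro α
    rw [Fintype.sum_unique, if_pos]
    · congr 1
      have : ∀ σ : Fin 0 → SignType, flat α σ = ⊤ := by
        intro σ
        refine eq_top_iff.2 fun v _ => ?_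
        rw [mem_flat]
        exact fun i => i.elim0
      rw [this, finrank_top]
    · obtain ⟨v, hv⟩ := hne
      exact ⟨v, hv, fun i => i.elim0⟩
  | succ n ih =>
    intro α
    rw [← (Fin.consEquiv fun _ => SignType).sum_comp, Fintype.sum_prod_type_right,
      ← ih fun i => α i.succ]
    -- It suffices that the new hyperplane leaves the contribution of each old face `τ` unchanged:
    -- its trace on `R` is convex and relatively open in `L`.
    refine Finset.sum_congr rfl fun τ _ => ?_
    set P : SignType → Prop := fun ε =>
      ∃ v ∈ R, SignType.sign (α 0 v) = ε ∧ ∀ i : Fin n, SignType.sign (α i.succ v) = τ i with hP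
    have hcond : ∀ ε : SignType, (∃ v ∈ R, ∀ i, SignType.sign (α i v) =
        (Fin.consEquiv fun _ => SignType) (ε, τ) i) ↔ P ε := by
      intro ε
      simp [hP, Fin.forall_fin_succ, Fin.consEquiv]
    have hsum : ∀ F : SignType → ℤ, ∑ ε, F ε = F 0 + F 1 + F (-1) := by
      intro F
      have : (Finset.univ : Finset SignType) = {0, 1, -1} := by decide
      rw [this, Finset.sum_insert (by decide), Finset.sum_insert (by decide),
        Finset.sum_singleton, add_assoc]
    simp only [hcond]
    rw [hsum]
    have h0 := (flat_cons α 0 τ).1 rfl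
    have h1 := (flat_cons α 1 τ).2 (by decide)
    have h2 := (flat_cons α (-1) τ).2 (by decide)
    change (if P 0 then (-1 : ℤ) ^ Module.finrank ℝ (flat α (Fin.cons 0 τ : Fin (n + 1) → SignType))
      else 0) + (if P 1 then (-1 : ℤ) ^ Module.finrank ℝ
        (flat α (Fin.cons 1 τ : Fin (n + 1) → SignType)) else 0) + (if P (-1) then
        (-1 : ℤ) ^ Module.finrank ℝ
        (flat α (Fin.cons (-1) τ : Fin (n + 1) → SignType)) else 0) = _
    rw [h0, h1, h2]
    set L := flat (fun i => α i.succ) τ with hL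
    have hmemL : ∀ v, (∀ i : Fin n, SignType.sign (α i.succ v) = τ i) → v ∈ L := by
      intro v hv
      rw [hL, mem_flat]
      intro i hi
      rw [← sign_eq_zero_iff, hv, hi]
    by_cases hex : ∃ v ∈ R, ∀ i : Fin n, SignType.sign (α i.succ v) = τ i
    swap
    · have hPn : ∀ ε, ¬ P ε := fun ε ⟨v, hv, _, h⟩ => hex ⟨v, hv, h⟩
      simp [hPn, hex]
    rw [if_pos hex]
    -- If the new form vanishes on `L`, the face is not cut and its flat does not change.
    by_cases hvan : L ≤ LinearMap.ker (α 0)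
    · have hP0 : P 0 := by
        obtain ⟨v, hv, h⟩ := hex
        exact ⟨v, hv, by rw [sign_eq_zero_iff]; exact hvan (hmemL v h), h⟩
      have hPn : ∀ ε, ε ≠ 0 → ¬ P ε := by
        rintro ε hε ⟨v, hv, h, h'⟩
        refine hε ?_
        rw [← h, sign_eq_zero_iff]
        exact hvan (hmemL v h')
      rw [if_pos hP0, if_neg (hPn _ (by decide)), if_neg (hPn _ (by decide)),
        inf_eq_left.2 hvan]
      simp
    · obtain ⟨u, huL, hu⟩ := Set.not_subset.1 hvan
      have hu : α 0 u ≠ 0 := hu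
      have hdim := finrank_inf_ker L (α 0) u huL hu
      rw [← hdim]
      have hmove : ∀ v ∈ R, (∀ i : Fin n, SignType.sign (α i.succ v) = τ i) →
          ∀ᶠ t in nhds (0 : ℝ), v + t • u ∈ R ∧
            ∀ i : Fin n, SignType.sign (α i.succ (v + t • u)) = τ i := by
        intro v hv h
        refine (hopen v hv u).and (Filter.eventually_all.2 fun i => ?_)
        have := eventually_sign_add_mul (α i.succ v) (α i.succ u) (fun h0 => by
          rw [hL, SetLike.mem_coe, mem_flat] at huL
          exact huL i (by rw [← h, h0, sign_zero]))
        filter_upwards [this] with t ht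
        rw [map_add, map_smul, smul_eq_mul, ht, h]
      -- Openness: a point on the new hyperplane can be pushed along `u ∈ L` to both sides.
      have h0pm : P 0 → P 1 ∧ P (-1) := by
        rintro ⟨v, hv, hz, h⟩
        rw [sign_eq_zero_iff] at hz
        obtain ⟨δ, hδ, hball⟩ := Metric.eventually_nhds_iff.1 (hmove v hv h)
        have key : ∀ t : ℝ, |t| < δ → P (SignType.sign (t * α 0 u)) := by
          intro t ht
          obtain ⟨h3, h4⟩ := hball (y := t) (by simpa [Real.dist_eq] using ht)
          exact ⟨_, h3, by simp [hz], h4⟩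
        have hpos : |δ / 2| < δ := by rw [abs_of_pos (by linarith)]; linarith
        have hneg : |-(δ / 2)| < δ := by rw [abs_neg]; exact hpos
        have k1 := key _ hpos
        have k2 := key _ hneg
        rcases lt_or_gt_of_ne hu with hu | hu
        · rw [sign_neg (mul_neg_of_pos_of_neg (by linarith) hu)] at k1
          rw [sign_pos (mul_pos_of_neg_of_neg (by linarith) hu)] at k2
          exact ⟨k2, k1⟩
        · rw [sign_pos (mul_pos (by linarith) hu)] at k1
          rw [sign_neg (mul_neg_of_neg_of_pos (by linarith) hu)] at k2
          exact ⟨k1, k2⟩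
      -- Convexity: the weights locate the zero of `α 0` on the segment from `v` to `w`.
      have hpm0 : P 1 → P (-1) → P 0 := by
        rintro ⟨v, hv, hv1, h⟩ ⟨w, hw, hw1, h'⟩
        rw [sign_eq_one_iff] at hv1
        rw [sign_eq_neg_one_iff] at hw1
        set a := α 0 v
        set b := α 0 w
        have hab : 0 < a - b := by linarith
        have ha' : 0 ≤ -b / (a - b) := div_nonneg (by linarith) hab.le
        have hb' : 0 ≤ a / (a - b) := div_nonneg (by linarith) hab.le
        have hsum1 : -b / (a - b) + a / (a - b) = 1 := by
          field_simp
          ring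
        refine ⟨(-b / (a - b)) • v + (a / (a - b)) • w, hconv hv hw ha' hb' hsum1, ?_, ?_⟩
        · rw [sign_eq_zero_iff, map_add, map_smul, map_smul]
          change -b / (a - b) * a + a / (a - b) * b = 0
          ring
        · intro i
          have hp : 0 < -b / (a - b) := div_pos (by linarith) hab
          have hq : 0 < a / (a - b) := div_pos (by linarith) hab
          have e1 := h i
          have e2 := h' i
          rw [map_add, map_smul, map_smul, smul_eq_mul, smul_eq_mul]
          rcases lt_trichotomy (α i.succ v) 0 with g | g | g
          · rw [sign_neg g] at e1
            rw [← e1, sign_eq_neg_one_iff] at e2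
            rw [← e1, sign_eq_neg_one_iff]
            nlinarith [mul_neg_of_pos_of_neg hp g, mul_neg_of_pos_of_neg hq e2]
          · rw [g, sign_zero] at e1
            rw [← e1, sign_eq_zero_iff] at e2
            rw [← e1, g, e2]
            simp
          · rw [sign_pos g] at e1
            rw [← e1, sign_eq_one_iff] at e2
            rw [← e1, sign_eq_one_iff]
            nlinarith [mul_pos hp g, mul_pos hq e2]
      -- With `m` the dimension of the cut, either all three pieces occur and `(-1)^m + 2(-1)^(m+1)
      -- = (-1)^(m+1)`, or exactly one side occurs.
      by_cases hP0 : P 0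
      · rw [if_pos hP0, if_pos (h0pm hP0).1, if_pos (h0pm hP0).2]
        ring
      · have hor : P 1 ∨ P (-1) := by
          obtain ⟨v, hv, h⟩ := hex
          rcases lt_trichotomy (α 0 v) 0 with g | g | g
          · exact Or.inr ⟨v, hv, sign_neg g, h⟩
          · exact absurd ⟨v, hv, by rw [g, sign_zero], h⟩ hP0
          · exact Or.inl ⟨v, hv, sign_pos g, h⟩
        rw [if_neg hP0, zero_add]
        rcases hor with h | h
        · rw [if_pos h, if_neg fun h' => hP0 (hpm0 h h'), add_zero]
        · rw [if_neg fun h' => hP0 (hpm0 h' h), if_pos h, zero_add]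

end

end SignVector

/-! ### Face sums localized by the hyperplanes separating a face from a chamber. -/

namespace SignVector

section

variable {V : Type*} [AddCommGroup V] [Module ℝ V] {ι : Type*}

/-- The sign vectors of the points of `V` with respect to a family of linear forms. -/
def IsCovector (α : ι → Module.Dual ℝ V) (σ : ι → SignType) : Prop :=
  ∃ v, ∀ i, SignType.sign (α i v) = σ i

open Classical in
theorem sum_faces_eq_of_fintype [Fintype ι] [FiniteDimensional ℝ V] (R : Set V) (hne : R.Nonempty)
    (hconv : Convex ℝ R) (hopen : ∀ v ∈ R, ∀ u, ∀ᶠ t in nhds (0 : ℝ), v + t • u ∈ R)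
    (α : ι → Module.Dual ℝ V) :
      ∑ σ : ι → SignType, (if ∃ v ∈ R, ∀ i, SignType.sign (α i v) = σ i then
        (-1 : ℤ) ^ Module.finrank ℝ (flat α σ) else 0) = (-1) ^ Module.finrank ℝ V := by
  have e := Fintype.equivFin ι
  rw [← sum_faces_eq R hne hconv hopen _ fun i => α (e.symm i)]
  refine Fintype.sum_equiv (Equiv.arrowCongr e (Equiv.refl _)) _ _ fun σ => ?_
  have h1 : flat α σ =
      flat (fun i => α (e.symm i)) (Equiv.arrowCongr e (Equiv.refl SignType) σ) := by
    ext v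
    rw [mem_flat, mem_flat, ← e.symm.forall_congr_right]
    rfl
  have h2 : (∃ v ∈ R, ∀ i, SignType.sign (α i v) = σ i) ↔ ∃ v ∈ R, ∀ i,
      SignType.sign (α (e.symm i) v) = Equiv.arrowCongr e (Equiv.refl SignType) σ i := by
    refine exists_congr fun v => and_congr_right fun _ => ?_
    rw [← e.symm.forall_congr_right]
    rfl
  rw [h1]
  simp only [h2]

theorem IsCovector.neg {α : ι → Module.Dual ℝ V} {σ : ι → SignType} (hσ : IsCovector α σ) :
    IsCovector α (-σ) := by
  obtain ⟨v, hv⟩ := hσ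
  exact ⟨-v, fun i => by rw [map_neg, Left.sign_neg, hv]; rfl⟩

/-- The uniqueness half of Möbius inversion on a Boolean lattice, by induction over proper subsets.
-/
theorem eq_of_sum_powerset_eq {M : Type*} [AddCommGroup M] (f g : Finset ι → M)
    (h : ∀ B : Finset ι, ∑ T ∈ B.powerset, f T = ∑ T ∈ B.powerset, g T) : f = g := by
  classical
  funext B
  induction B using Finset.strongInduction with
  | H B ih =>
    have hB := h B
    rw [← Finset.add_sum_erase _ f (Finset.mem_powerset_self B),
      ← Finset.add_sum_erase _ g (Finset.mem_powerset_self B)] at hB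
    rw [Finset.sum_congr rfl fun T hT => ih T (Finset.ssubset_iff_subset_ne.2
      ⟨Finset.mem_powerset.1 (Finset.mem_of_mem_erase hT), Finset.ne_of_mem_erase hT⟩)] at hB
    exact add_right_cancel hB

variable [Fintype ι]

/-- The set of indices where two sign vectors differ. -/
def diff (σ τ : ι → SignType) : Finset ι := Finset.univ.filter fun i => σ i ≠ τ i

@[simp]
theorem mem_diff (σ τ : ι → SignType) (i : ι) : i ∈ diff σ τ ↔ σ i ≠ τ i := by
  simp [diff]

theorem sign_add_eq {a b : ℝ} (h : SignType.sign a = SignType.sign b) {x y : ℝ} (hx : 0 ≤ x)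
    (hy : 0 ≤ y) (hxy : 0 < x + y) : SignType.sign (x * a + y * b) = SignType.sign a := by
  rcases lt_trichotomy a 0 with g | g | g
  · rw [sign_neg g, eq_comm, sign_eq_neg_one_iff] at h
    rw [sign_neg g, sign_eq_neg_one_iff]
    rcases hx.eq_or_lt with rfl | hx
    · have : 0 < y := by linarith
      nlinarith
    · nlinarith [mul_neg_of_pos_of_neg hx g, mul_nonpos_of_nonneg_of_nonpos hy h.le]
  · rw [g, sign_zero, eq_comm, sign_eq_zero_iff] at h
    simp [g, h]
  · rw [sign_pos g, eq_comm, sign_eq_one_iff] at h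
    rw [sign_pos g, sign_eq_one_iff]
    rcases hx.eq_or_lt with rfl | hx
    · have : 0 < y := by linarith
      nlinarith
    · nlinarith [mul_pos hx g, mul_nonneg hy h.le]

open Classical in
-- The faces counted are those meeting the region on the side of `s` for every hyperplane outside
-- `B`. This region is an intersection of open half-spaces because `s` has no zeros.
theorem sum_covector_region [FiniteDimensional ℝ V] (α : ι → Module.Dual ℝ V) (s : ι → SignType)
    (hs : IsCovector α s) (hs0 : ∀ i, s i ≠ 0) (B : Finset ι) :
    ∑ σ : ι → SignType with IsCovector α σ ∧ diff σ s ⊆ B,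
      (-1 : ℤ) ^ Module.finrank ℝ (flat α σ) = (-1) ^ Module.finrank ℝ V := by
  rw [← sum_faces_eq_of_fintype {v | ∀ i, i ∉ B → SignType.sign (α i v) = s i} ?_ ?_ ?_ α,
    Finset.sum_filter]
  · refine Finset.sum_congr rfl fun σ _ => ?_
    have : (IsCovector α σ ∧ diff σ s ⊆ B) ↔
        ∃ v ∈ {v | ∀ i, i ∉ B → SignType.sign (α i v) = s i},
          ∀ i, SignType.sign (α i v) = σ i := by
      constructor
      · rintro ⟨⟨v, hv⟩, h⟩
        refine ⟨v, fun i hi => ?_, hv⟩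
        rw [hv]
        by_contra h'
        exact hi (h ((mem_diff _ _ _).2 h'))
      · rintro ⟨v, h, hv⟩
        refine ⟨⟨v, hv⟩, fun i hi => ?_⟩
        by_contra h'
        refine (mem_diff _ _ _).1 hi ?_
        rw [← hv, h i h']
    simp only [this]
  · obtain ⟨v, hv⟩ := hs
    exact ⟨v, fun i _ => hv i⟩
  · intro v hv w hw a b ha hb hab i hi
    rw [map_add, map_smul, map_smul, smul_eq_mul, smul_eq_mul,
      sign_add_eq ((hv i hi).trans (hw i hi).symm) ha hb (by linarith), hv i hi]
  · intro v hv u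
    refine Filter.eventually_all.2 fun i => ?_
    by_cases hi : i ∈ B
    · simp [hi]
    · have h := hv i hi
      filter_upwards [eventually_sign_add_mul (α i v) (α i u) (fun h0 => by
        rw [h0, sign_zero] at h
        exact absurd h.symm (hs0 i))] with t ht _
      rw [map_add, map_smul, smul_eq_mul, ht, h]

open Classical in
-- The sums over `T ⊆ B` do not depend on `B`, so by Möbius inversion all the mass sits at `T = ∅`.
theorem sum_covector_diff_eq [FiniteDimensional ℝ V] (α : ι → Module.Dual ℝ V) (s : ι → SignType)
    (hs : IsCovector α s) (hs0 : ∀ i, s i ≠ 0) (T : Finset ι) :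
    ∑ σ : ι → SignType with IsCovector α σ ∧ diff σ s = T,
      (-1 : ℤ) ^ Module.finrank ℝ (flat α σ) =
        if T = ∅ then (-1) ^ Module.finrank ℝ V else 0 := by
  refine congrFun (eq_of_sum_powerset_eq (fun T : Finset ι =>
    ∑ σ : ι → SignType with IsCovector α σ ∧ diff σ s = T,
      (-1 : ℤ) ^ Module.finrank ℝ (flat α σ))
    (fun T => if T = ∅ then (-1) ^ Module.finrank ℝ V else 0) fun B => ?_) T
  rw [Finset.sum_ite_eq' B.powerset ∅, if_pos (Finset.empty_mem_powerset B),
    ← sum_covector_region α s hs hs0 B,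
    ← Finset.sum_fiberwise_of_maps_to (g := fun σ => diff σ s) (t := B.powerset)]
  · refine Finset.sum_congr rfl fun T hT => Finset.sum_congr ?_ fun _ _ => rfl
    ext σ
    simp only [Finset.mem_filter, Finset.mem_univ, true_and]
    rw [Finset.mem_powerset] at hT
    grind
  · intro σ hσ
    simp only [Finset.mem_filter] at hσ
    exact Finset.mem_powerset.2 hσ.2.2

open Classical in
-- The faces with a fixed nonempty difference set already cancel, so a factor depending only on that
-- set does no harm.
theorem sum_covector_region_pow [FiniteDimensional ℝ V] {A : Type*} [CommRing A] (x : A)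
    (α : ι → Module.Dual ℝ V) (s : ι → SignType)
    (hs : IsCovector α s) (hs0 : ∀ i, s i ≠ 0) (B : Finset ι) :
    ∑ σ : ι → SignType with IsCovector α σ ∧ diff σ s ⊆ B,
      (-1 : A) ^ Module.finrank ℝ (flat α σ) * x ^ (diff σ s).card =
        (-1) ^ Module.finrank ℝ V := by
  rw [← Finset.sum_fiberwise_of_maps_to (g := fun σ => diff σ s) (t := B.powerset)]
  · have key : ∀ T ∈ B.powerset, ∑ σ ∈ (Finset.univ.filter fun σ =>
        IsCovector α σ ∧ diff σ s ⊆ B) with diff σ s = T,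
        (-1 : A) ^ Module.finrank ℝ (flat α σ) * x ^ (diff σ s).card =
        if T = ∅ then (-1) ^ Module.finrank ℝ V else 0 := by
      intro T hT
      rw [Finset.mem_powerset] at hT
      have h := congrArg (fun z : ℤ => (z : A) * x ^ T.card)
        (sum_covector_diff_eq α s hs hs0 T)
      simp only [Int.cast_sum, Finset.sum_mul] at h
      have h' : ((if T = ∅ then (-1) ^ Module.finrank ℝ V else 0 : ℤ) : A) * x ^ T.card =
          if T = ∅ then (-1) ^ Module.finrank ℝ V else 0 := by
        split_ifs with hT0
        · simp [hT0]
        · simp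
      rw [h'] at h
      rw [← h, Finset.filter_filter]
      refine Finset.sum_congr ?_ fun σ hσ => ?_
      · ext σ
        simp only [Finset.mem_filter, Finset.mem_univ, true_and]
        grind
      · simp only [Finset.mem_filter] at hσ
        rw [hσ.2.2]
        simp
    rw [Finset.sum_congr rfl key, Finset.sum_ite_eq' B.powerset ∅,
      if_pos (Finset.empty_mem_powerset B)]
  · intro σ hσ
    simp only [Finset.mem_filter] at hσ
    exact Finset.mem_powerset.2 hσ.2.2

/-- The composition of sign vectors. -/
def comp (σ τ : ι → SignType) (i : ι) : SignType := if σ i = 0 then τ i else σ i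

/-- A small step from a point of `σ` in the direction of a point of `τ` keeps the nonzero signs and
fills the zeros. -/
theorem IsCovector.comp {α : ι → Module.Dual ℝ V} {σ τ : ι → SignType} (hσ : IsCovector α σ)
    (hτ : IsCovector α τ) : IsCovector α (comp σ τ) := by
  obtain ⟨v, hv⟩ := hσ
  obtain ⟨w, hw⟩ := hτ
  have h : ∀ᶠ t in nhds (0 : ℝ), ∀ i, σ i ≠ 0 → SignType.sign (α i (v + t • w)) = σ i := by
    refine Filter.eventually_all.2 fun i => ?_
    by_cases hi : σ i = 0
    · simp [hi]
    filter_upwards [eventually_sign_add_mul (α i v) (α i w) fun h0 => by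
      rw [← hv, h0, sign_zero] at hi
      exact absurd rfl hi] with t ht _
    rw [map_add, map_smul, smul_eq_mul, ht, hv]
  obtain ⟨δ, hδ, hball⟩ := Metric.eventually_nhds_iff.1 h
  have hd : |δ / 2| < δ := by rw [abs_of_pos (by linarith)]; linarith
  refine ⟨v + (δ / 2) • w, fun i => ?_⟩
  unfold SignVector.comp
  split_ifs with hi
  · have h0 : α i v = 0 := by rw [← sign_eq_zero_iff, hv, hi]
    rw [map_add, map_smul, smul_eq_mul, h0, zero_add, sign_mul, sign_pos (by linarith), one_mul, hw]
  · exact hball (by rwa [Real.dist_eq, sub_zero]) i hi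

end

end SignVector

/-! ### Restricted zeta matrices, weightings and path series. -/

namespace SignVector

open scoped PowerSeries Matrix

section

variable {ι : Type*} [Fintype ι] {Ch : Type*} [DecidableEq Ch]

open Classical in
/-- The matrix `[q ^ d(C, D)]`, restricted to the pairs separated only by members of `B`. -/
noncomputable def zeta (s : Ch → ι → SignType) (B : Finset ι) : Matrix Ch Ch ℚ⟦X⟧ :=
  Matrix.of fun C D =>
    if diff (s C) (s D) ⊆ B then PowerSeries.X ^ (diff (s C) (s D)).card else 0

theorem diff_eq_empty {σ τ : ι → SignType} : diff σ τ = ∅ ↔ σ = τ := by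
  rw [Finset.eq_empty_iff_forall_notMem, funext_iff]
  simp

theorem diff_self (σ : ι → SignType) : diff σ σ = ∅ := diff_eq_empty.2 rfl

open Classical in
/-- The members of the index set crossed by a path of chambers. -/
noncomputable def cross (s : Ch → ι → SignType) {k : ℕ} (x : Fin (k + 1) → Ch) : Finset ι :=
  Finset.univ.biUnion fun i : Fin k => diff (s (x i.castSucc)) (s (x i.succ))

/-- The number of crossings of a path of chambers, with multiplicity. -/
def pathLength (s : Ch → ι → SignType) {k : ℕ} (x : Fin (k + 1) → Ch) : ℕ :=
  ∑ i : Fin k, (diff (s (x i.castSucc)) (s (x i.succ))).card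

theorem zeta_sub_one_apply (s : Ch → ι → SignType) (B : Finset ι) (C D : Ch) :
    open Classical in (zeta s B - 1) C D = if C ≠ D ∧ diff (s C) (s D) ⊆ B then
      PowerSeries.X ^ (diff (s C) (s D)).card else 0 := by
  by_cases h : C = D
  · subst h
    simp [zeta, diff_self]
  · rw [Matrix.sub_apply, Matrix.one_apply_ne h, sub_zero, zeta, Matrix.of_apply]
    by_cases h2 : diff (s C) (s D) ⊆ B <;> simp [h, h2]

theorem prod_zeta_sub_one (s : Ch → ι → SignType) (B : Finset ι) {k : ℕ} (x : Fin (k + 1) → Ch) :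
    open Classical in ∏ i : Fin k, (zeta s B - 1) (x i.castSucc) (x i.succ) =
      if (∀ i : Fin k, x i.castSucc ≠ x i.succ) ∧ cross s x ⊆ B then
      PowerSeries.X ^ pathLength s x else 0 := by
  classical
  simp only [zeta_sub_one_apply]
  split_ifs with h
  · rw [pathLength, ← Finset.prod_pow_eq_pow_sum]
    refine Finset.prod_congr rfl fun i _ => if_pos ⟨h.1 i, ?_⟩
    exact (Finset.subset_biUnion_of_mem (fun i : Fin k => diff (s (x i.castSucc)) (s (x i.succ)))
      (Finset.mem_univ i)).trans h.2
  · have : ∃ i : Fin k, ¬ (x i.castSucc ≠ x i.succ ∧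
        diff (s (x i.castSucc)) (s (x i.succ)) ⊆ B) := by
      by_contra h'
      push Not at h'
      exact h ⟨fun i => (h' i).1, Finset.biUnion_subset.2 fun i _ => (h' i).2⟩
    obtain ⟨i, hi⟩ := this
    exact Finset.prod_eq_zero (Finset.mem_univ i) (if_neg hi)

variable [Fintype Ch]

/-- Distinct chambers have positive distance, so the matrix of constant terms is the identity. -/
theorem isUnit_det_zeta (s : Ch → ι → SignType) (hs : Function.Injective s) (B : Finset ι) :
    IsUnit (zeta s B).det := by
  rw [PowerSeries.isUnit_iff_constantCoeff, RingHom.map_det]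
  have : (PowerSeries.constantCoeff (R := ℚ)).mapMatrix (zeta s B) = 1 := by
    ext C D
    rw [RingHom.mapMatrix_apply, Matrix.map_apply, zeta, Matrix.of_apply]
    by_cases h : C = D
    · subst h
      simp [diff_self]
    · rw [Matrix.one_apply_ne h]
      have : (diff (s C) (s D)).card ≠ 0 := by
        rw [Finset.card_ne_zero, Finset.nonempty_iff_ne_empty, Ne, diff_eq_empty]
        exact fun h' => h (hs h')
      split_ifs
      · rw [map_pow, PowerSeries.constantCoeff_X, zero_pow this]
      · simp
  rw [this, Matrix.det_one]
  exact isUnit_one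

/-- The weighting `Z_B⁻¹ 1`. -/
noncomputable def weighting (s : Ch → ι → SignType) (B : Finset ι) : Ch → ℚ⟦X⟧ :=
  (zeta s B)⁻¹ *ᵥ 1

theorem zeta_mulVec_weighting (s : Ch → ι → SignType) (hs : Function.Injective s)
    (B : Finset ι) : zeta s B *ᵥ weighting s B = 1 := by
  rw [weighting, Matrix.mulVec_mulVec, Matrix.mul_nonsing_inv _ (isUnit_det_zeta s hs B),
    Matrix.one_mulVec]

theorem eq_weighting (s : Ch → ι → SignType) (hs : Function.Injective s)
    (B : Finset ι) (w : Ch → ℚ⟦X⟧) (c : ℚ⟦X⟧) (hw : zeta s B *ᵥ w = fun _ => c) :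
    w = c • weighting s B := by
  have h : (zeta s B)⁻¹ *ᵥ (zeta s B *ᵥ w) = (zeta s B)⁻¹ *ᵥ (c • 1) := by
    rw [hw]
    congr 1
    funext i
    simp
  rwa [Matrix.mulVec_mulVec, Matrix.nonsing_inv_mul _ (isUnit_det_zeta s hs B),
    Matrix.one_mulVec, Matrix.mulVec_smul] at h

open Classical in
/-- The proper paths of given length that cross exactly the members of `T`. -/
noncomputable def paths (s : Ch → ι → SignType) (k l : ℕ) (T : Finset ι) :
    Finset (Fin (k + 1) → Ch) :=
  Finset.univ.filter fun x => (∀ i : Fin k, x i.castSucc ≠ x i.succ) ∧ pathLength s x = l ∧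
    cross s x = T

theorem pow_mulVec_one_apply {A : Type*} [CommRing A] (N : Matrix Ch Ch A) (k : ℕ) (C : Ch) :
    (N ^ k *ᵥ 1) C = ∑ y : Fin k → Ch, ∏ i : Fin k,
      N ((Fin.cons C y : Fin (k + 1) → Ch) i.castSucc) ((Fin.cons C y : Fin (k + 1) → Ch) i.succ) := by
  induction k generalizing C with
  | zero => simp
  | succ k ih =>
    rw [pow_succ', ← Matrix.mulVec_mulVec, ← (Fin.consEquiv fun _ => Ch).sum_comp,
      Fintype.sum_prod_type]
    change ∑ D, N C D * (N ^ k *ᵥ 1) D = _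
    refine Finset.sum_congr rfl fun D _ => ?_
    rw [ih, Finset.mul_sum]
    refine Finset.sum_congr rfl fun y _ => ?_
    rw [Fin.prod_univ_succ]
    rfl

theorem sum_pow_mulVec_one {A : Type*} [CommRing A] (N : Matrix Ch Ch A) (k : ℕ) :
    ∑ C, (N ^ k *ᵥ 1) C = ∑ x : Fin (k + 1) → Ch, ∏ i : Fin k, N (x i.castSucc) (x i.succ) := by
  rw [← (Fin.consEquiv fun _ => Ch).sum_comp, Fintype.sum_prod_type]
  exact Finset.sum_congr rfl fun C _ => pow_mulVec_one_apply N k C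

theorem coeff_sum_pow (s : Ch → ι → SignType) (B : Finset ι) (k l : ℕ) :
    PowerSeries.coeff l (∑ C, ((zeta s B - 1) ^ k *ᵥ 1) C) =
      ∑ T ∈ B.powerset, ((paths s k l T).card : ℚ) := by
  classical
  rw [sum_pow_mulVec_one, map_sum]
  simp only [prod_zeta_sub_one]
  have h1 : ∀ x : Fin (k + 1) → Ch, PowerSeries.coeff l (if (∀ i : Fin k, x i.castSucc ≠ x i.succ) ∧
      cross s x ⊆ B then (PowerSeries.X : ℚ⟦X⟧) ^ pathLength s x else 0) =
      if (∀ i : Fin k, x i.castSucc ≠ x i.succ) ∧ cross s x ⊆ B ∧ pathLength s x = l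
        then 1 else 0 := by
    intro x
    split_ifs with h h' h'
    · rw [h'.2.2, PowerSeries.coeff_X_pow_self]
    · rw [PowerSeries.coeff_X_pow, if_neg]
      exact fun h2 => h' ⟨h.1, h.2, h2.symm⟩
    · exact absurd ⟨h'.1, h'.2.1⟩ h
    · exact map_zero _
  rw [Finset.sum_congr rfl fun x _ => h1 x, Finset.sum_boole, ← Nat.cast_sum]
  congr 1
  rw [Finset.card_eq_sum_card_fiberwise (f := fun x => cross s x) (t := B.powerset)]
  · refine Finset.sum_congr rfl fun T hT => congrArg Finset.card ?_
    rw [Finset.mem_powerset] at hT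
    ext x
    simp only [paths, Finset.mem_filter, Finset.mem_univ, true_and]
    constructor
    · rintro ⟨⟨h1, h2, h3⟩, h4⟩
      exact ⟨h1, h3, h4⟩
    · rintro ⟨h1, h3, h4⟩
      exact ⟨⟨h1, h4 ▸ hT, h3⟩, h4⟩
  · intro x hx
    simp only [Finset.coe_filter, Set.mem_ofPred_eq] at hx
    exact Finset.mem_coe.2 (Finset.mem_powerset.2 hx.2.2.1)

/-- Every proper step crosses at least one hyperplane; this makes the Neumann series converge
`X`-adically. -/
theorem X_pow_dvd_pow_apply (s : Ch → ι → SignType) (hs : Function.Injective s) (B : Finset ι)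
    (k : ℕ) (C D : Ch) :
    (PowerSeries.X : ℚ⟦X⟧) ^ k ∣ ((zeta s B - 1) ^ k) C D := by
  induction k generalizing C D with
  | zero => simp
  | succ k ih =>
    rw [pow_succ (zeta s B - 1), Matrix.mul_apply, pow_succ]
    refine Finset.dvd_sum fun E _ => mul_dvd_mul (ih C E) ?_
    rw [zeta_sub_one_apply]
    split_ifs with h
    · refine dvd_pow_self _ ?_
      rw [Finset.card_ne_zero, Finset.nonempty_iff_ne_empty, Ne, diff_eq_empty]
      exact fun h' => h.1 (hs h')
    · exact dvd_zero _

/-- The signed generating series of the proper paths crossing exactly the members of `T`. -/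
noncomputable def pathSeries (s : Ch → ι → SignType) (T : Finset ι) : ℚ⟦X⟧ :=
  PowerSeries.mk fun l => ∑ k ∈ Finset.range (l + 1), (-1) ^ k * ((paths s k l T).card : ℚ)

/-- With `N = zeta s B - 1`, the inverse is `∑ (-N)^k`, and the entries of `N^k` enumerate the
proper `k`-step paths that cross only members of `B`. -/
theorem sum_weighting_eq (s : Ch → ι → SignType) (hs : Function.Injective s) (B : Finset ι) :
    ∑ C, weighting s B C = ∑ T ∈ B.powerset, pathSeries s T := by
  ext l
  set N := zeta s B - 1 with hN
  have hgeom : ∑ k ∈ Finset.range (l + 1), (-N) ^ k =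
      (zeta s B)⁻¹ - (zeta s B)⁻¹ * (-N) ^ (l + 1) := by
    have h := mul_neg_geom_sum (-N) (l + 1)
    rw [sub_neg_eq_add, hN, add_sub_cancel] at h
    rw [← mul_one_sub, hN, ← h, ← mul_assoc,
      Matrix.nonsing_inv_mul _ (isUnit_det_zeta s hs B), one_mul]
  have hw : ∀ C, weighting s B C = ∑ k ∈ Finset.range (l + 1), (-1) ^ k * (N ^ k *ᵥ 1) C +
      (((zeta s B)⁻¹ * (-N) ^ (l + 1)) *ᵥ 1) C := by
    intro C
    have h : (zeta s B)⁻¹ = ∑ k ∈ Finset.range (l + 1), (-N) ^ k +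
        (zeta s B)⁻¹ * (-N) ^ (l + 1) := by rw [hgeom, sub_add_cancel]
    rw [weighting]
    nth_rewrite 1 [h]
    rw [Matrix.add_mulVec, Matrix.sum_mulVec, Pi.add_apply, Finset.sum_apply]
    congr 1
    refine Finset.sum_congr rfl fun k _ => ?_
    rcases Nat.even_or_odd k with hk | hk
    · rw [hk.neg_pow, hk.neg_one_pow, one_mul]
    · rw [hk.neg_pow, hk.neg_one_pow, Matrix.neg_mulVec, Pi.neg_apply, neg_one_mul]
  -- The remainder is divisible by `X^(l+1)`, so the terms `k ≤ l` determine coefficient `l`.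
  have hzero : ∀ C, PowerSeries.coeff l ((((zeta s B)⁻¹ * (-N) ^ (l + 1)) *ᵥ 1) C) = 0 := by
    intro C
    refine PowerSeries.X_pow_dvd_iff.1 ?_ l (Nat.lt_succ_self l)
    refine Finset.dvd_sum fun D _ => ?_
    simp only [Pi.one_apply, mul_one]
    rw [Matrix.mul_apply]
    refine Finset.dvd_sum fun E _ => Dvd.dvd.mul_left ?_ _
    have := X_pow_dvd_pow_apply s hs B (l + 1) E D
    rw [neg_pow, ← hN] at *
    rcases Nat.even_or_odd (l + 1) with hk | hk
    · rw [hk.neg_one_pow, one_mul]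
      exact this
    · rw [hk.neg_one_pow, neg_one_mul, Matrix.neg_apply]
      exact this.neg_right
  simp only [hw, map_sum, map_add, hzero, add_zero, pathSeries, PowerSeries.coeff_mk]
  rw [Finset.sum_comm, Finset.sum_comm (s := B.powerset)]
  refine Finset.sum_congr rfl fun k _ => ?_
  rw [← Finset.mul_sum, ← coeff_sum_pow, map_sum, Finset.mul_sum]
  refine Finset.sum_congr rfl fun C _ => ?_
  rcases Nat.even_or_odd k with hk | hk
  · rw [hk.neg_one_pow, hk.neg_one_pow, one_mul, one_mul]
  · rw [hk.neg_one_pow, hk.neg_one_pow, neg_one_mul, neg_one_mul, map_neg]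

end

end SignVector

/-! ### Weightings of stars of faces, and reciprocity. -/

namespace SignVector

open scoped PowerSeries Matrix

section

variable {V : Type*} [AddCommGroup V] [Module ℝ V] {ι : Type*} {Ch : Type*}

/-- The chambers `Ch` are in bijection with the covectors without zeros. -/
structure IsChamberSystem (α : ι → Module.Dual ℝ V) (s : Ch → ι → SignType) : Prop where
  injective : Function.Injective s
  isCovector : ∀ C, IsCovector α (s C)
  ne_zero : ∀ C i, s C i ≠ 0
  surj : ∀ σ, IsCovector α σ → (∀ i, σ i ≠ 0) → ∃ C, s C = σ

variable [Fintype ι]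

/-- The indices of the hyperplanes containing a face. -/
def zeroSet (σ : ι → SignType) : Finset ι := Finset.univ.filter fun i => σ i = 0

@[simp]
theorem mem_zeroSet (σ : ι → SignType) (i : ι) : i ∈ zeroSet σ ↔ σ i = 0 := by
  simp [zeroSet]

theorem flat_eq_iInf_zeroSet (α : ι → Module.Dual ℝ V) (σ : ι → SignType) :
    flat α σ = ⨅ i ∈ zeroSet σ, LinearMap.ker (α i) := by
  simp [flat]

variable [Fintype Ch] [DecidableEq Ch]

open Classical in
/-- The weighting of the star of a face, extended by zero. -/
noncomputable def faceWeighting (s : Ch → ι → SignType) (σ : ι → SignType) (C : Ch) : ℚ⟦X⟧ :=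
  if ∀ i, σ i ≠ 0 → s C i = σ i then weighting s (zeroSet σ) C else 0

open Classical in
-- The composition `E` of `σ` and `D` is the gate from `D` into the star of `σ`: for `C` in the
-- star, `d(D, C) = d(D, E) + d(E, C)`. The first summand factors out, and what remains is the
-- weighting equation of the star in row `E`.
theorem zeta_mulVec_faceWeighting {α : ι → Module.Dual ℝ V} {s : Ch → ι → SignType}
    (h : IsChamberSystem α s) {σ : ι → SignType} (hσ : IsCovector α σ) {B : Finset ι}
    (hB : zeroSet σ ⊆ B) (D : Ch) :
    (PowerSeries.X : ℚ⟦X⟧) ^ (zeroSet σ).card * (zeta s B *ᵥ faceWeighting s σ) D =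
      if diff σ (s D) ⊆ B then PowerSeries.X ^ (diff σ (s D)).card else 0 := by
  obtain ⟨E, hE⟩ := h.surj _ (hσ.comp (h.isCovector D)) fun i => by
    unfold comp
    split_ifs with h0
    · exact h.ne_zero D i
    · exact h0
  have hE0 : ∀ i, σ i = 0 → s E i = s D i := fun i hi => by rw [hE, comp, if_pos hi]
  have hE1 : ∀ i, σ i ≠ 0 → s E i = σ i := fun i hi => by rw [hE, comp, if_neg hi]
  -- `P` separates `D` from its gate. Since `D` has no zeros, `diff σ (s D)` is the disjoint union
  -- of `P` and the zero set, whence the power of `X` in the statement.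
  set P : Finset ι := diff σ (s D) \ zeroSet σ with hP
  have hzd : zeroSet σ ⊆ diff σ (s D) := by
    intro i hi
    rw [mem_zeroSet] at hi
    rw [mem_diff, hi]
    exact (h.ne_zero D i).symm
  have hPB : P ⊆ B ↔ diff σ (s D) ⊆ B := by
    constructor
    · intro hP' i hi
      by_cases h0 : i ∈ zeroSet σ
      · exact hB h0
      · exact hP' (Finset.mem_sdiff.2 ⟨hi, h0⟩)
    · exact fun hd => Finset.sdiff_subset.trans hd
  have key : ∀ C, zeta s B D C * faceWeighting s σ C =
      (if P ⊆ B then PowerSeries.X ^ P.card else 0) *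
        (zeta s (zeroSet σ) E C * weighting s (zeroSet σ) C) := by
    intro C
    rw [faceWeighting]
    split_ifs with hC hPB' hPB'
    · have hsub : diff (s E) (s C) ⊆ zeroSet σ := by
        intro i hi
        rw [mem_diff] at hi
        rw [mem_zeroSet]
        by_contra h0
        exact hi ((hE1 i h0).trans (hC i h0).symm)
      have hun : diff (s D) (s C) = P ∪ diff (s E) (s C) := by
        ext i
        simp only [hP, Finset.mem_union, Finset.mem_sdiff, mem_diff, mem_zeroSet]
        by_cases h0 : σ i = 0
        · simp [h0, hE0 i h0]
        · simp [h0, hE1 i h0, hC i h0, eq_comm]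
      have hdisj : Disjoint P (diff (s E) (s C)) :=
        Finset.disjoint_of_subset_right hsub Finset.sdiff_disjoint
      rw [zeta, zeta, Matrix.of_apply, Matrix.of_apply, if_pos hsub, hun,
        if_pos (Finset.union_subset hPB' (hsub.trans hB)), Finset.card_union_of_disjoint hdisj,
        pow_add, mul_assoc]
    · have hun : P ⊆ diff (s D) (s C) := by
        intro i hi
        rw [hP, Finset.mem_sdiff, mem_diff, mem_zeroSet] at hi
        rw [mem_diff, hC i hi.2]
        exact hi.1.symm
      rw [zeta, Matrix.of_apply, if_neg fun h' => hPB' (hun.trans h'), zero_mul, zero_mul]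
    -- Outside the star both products vanish: `E` and `C` differ at some index where `σ` is nonzero.
    all_goals
      have hsub : ¬ diff (s E) (s C) ⊆ zeroSet σ := by
        intro hsub
        refine hC fun i hi => ?_
        by_contra hne
        refine hi ((mem_zeroSet _ _).1 (hsub ((mem_diff _ _ _).2 ?_)))
        rw [hE1 i hi]
        exact fun h' => hne h'.symm
      rw [zeta, zeta, Matrix.of_apply, Matrix.of_apply, if_neg hsub]
      simp
  have hmul : (zeta s B *ᵥ faceWeighting s σ) D = if P ⊆ B then PowerSeries.X ^ P.card else 0 := by
    change ∑ C, zeta s B D C * faceWeighting s σ C = _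
    rw [Finset.sum_congr rfl fun C _ => key C, ← Finset.mul_sum]
    have := congrFun (zeta_mulVec_weighting s h.injective (zeroSet σ)) E
    change ∑ C, zeta s (zeroSet σ) E C * weighting s (zeroSet σ) C = 1 at this
    rw [this, mul_one]
  rw [hmul]
  simp only [hPB]
  split_ifs
  · rw [← pow_add, ← Finset.card_sdiff_add_card_eq_card hzd, add_comm]
  · rw [mul_zero]

open Classical in
-- In row `D`, the signed combination of face weightings is mapped by `zeta s B` to the face sum of
-- `sum_covector_region_pow`, which is the same constant for all `D`. Invertibility then identifies
-- the combination with a multiple of the weighting.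
theorem sum_weighting_eq_sum_covector [FiniteDimensional ℝ V] {α : ι → Module.Dual ℝ V}
    {s : Ch → ι → SignType} (h : IsChamberSystem α s) (B : Finset ι) :
    (-1) ^ Module.finrank ℝ V * ∑ C, weighting s B C =
      ∑ σ : ι → SignType with IsCovector α σ ∧ zeroSet σ ⊆ B,
        (-1) ^ Module.finrank ℝ (flat α σ) *
          (PowerSeries.X ^ (zeroSet σ).card * ∑ C, faceWeighting s σ C) := by
  set w : Ch → ℚ⟦X⟧ := ∑ σ : ι → SignType with IsCovector α σ ∧ zeroSet σ ⊆ B,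
    ((-1) ^ Module.finrank ℝ (flat α σ) * PowerSeries.X ^ (zeroSet σ).card : ℚ⟦X⟧) •
      faceWeighting s σ with hw
  have hz : zeta s B *ᵥ w = fun _ => (-1) ^ Module.finrank ℝ V := by
    funext D
    rw [hw, Matrix.mulVec_sum, Finset.sum_apply,
      ← sum_covector_region_pow (PowerSeries.X : ℚ⟦X⟧) α (s D) (h.isCovector D) (h.ne_zero D) B]
    have hfil : (Finset.univ.filter fun σ : ι → SignType => IsCovector α σ ∧ diff σ (s D) ⊆ B) =
        (Finset.univ.filter fun σ : ι → SignType => IsCovector α σ ∧ zeroSet σ ⊆ B).filter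
          fun σ => diff σ (s D) ⊆ B := by
      ext σ
      simp only [Finset.mem_filter, Finset.mem_univ, true_and]
      refine ⟨fun h' => ⟨⟨h'.1, fun i hi => h'.2 ?_⟩, h'.2⟩, fun h' => ⟨h'.1.1, h'.2⟩⟩
      rw [mem_zeroSet] at hi
      rw [mem_diff, hi]
      exact (h.ne_zero D i).symm
    rw [hfil]
    refine Eq.trans ?_ (Finset.sum_filter _ _).symm
    refine Finset.sum_congr rfl fun σ hσ => ?_
    simp only [Finset.mem_filter, Finset.mem_univ, true_and] at hσ
    rw [Matrix.mulVec_smul, Pi.smul_apply, smul_eq_mul, mul_assoc,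
      zeta_mulVec_faceWeighting h hσ.1 hσ.2 D]
    split_ifs
    · rfl
    · rw [mul_zero]
  have hfin := eq_weighting s h.injective B w _ hz
  have hsum := congrArg (fun f : Ch → ℚ⟦X⟧ => ∑ C, f C) hfin
  simp only [Pi.smul_apply, smul_eq_mul, ← Finset.mul_sum] at hsum
  rw [← hsum, hw]
  simp only [Finset.sum_apply, Pi.smul_apply, smul_eq_mul]
  rw [Finset.sum_comm]
  refine Finset.sum_congr rfl fun σ _ => ?_
  rw [← Finset.mul_sum, mul_assoc]

open Classical in
-- Summed over `T ⊆ B`, both sides give the total weighting of `B` up to the common sign; Möbius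
-- inversion separates the individual `T`.
theorem pathSeries_eq_sum_covector [FiniteDimensional ℝ V] {α : ι → Module.Dual ℝ V}
    {s : Ch → ι → SignType} (h : IsChamberSystem α s) (T : Finset ι) :
    (-1) ^ Module.finrank ℝ V * pathSeries s T =
      ∑ σ : ι → SignType with IsCovector α σ ∧ zeroSet σ = T,
        (-1) ^ Module.finrank ℝ (flat α σ) *
          (PowerSeries.X ^ (zeroSet σ).card * ∑ C, faceWeighting s σ C) := by
  refine congrFun (eq_of_sum_powerset_eq (fun T => (-1) ^ Module.finrank ℝ V * pathSeries s T)
    (fun T => ∑ σ : ι → SignType with IsCovector α σ ∧ zeroSet σ = T,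
        (-1) ^ Module.finrank ℝ (flat α σ) *
          (PowerSeries.X ^ (zeroSet σ).card * ∑ C, faceWeighting s σ C)) fun B => ?_) T
  rw [← Finset.mul_sum, ← sum_weighting_eq s h.injective, sum_weighting_eq_sum_covector h,
    ← Finset.sum_fiberwise_of_maps_to (g := zeroSet) (t := B.powerset)]
  · refine Finset.sum_congr rfl fun T hT => Finset.sum_congr ?_ fun _ _ => rfl
    rw [Finset.mem_powerset] at hT
    ext σ
    simp only [Finset.mem_filter, Finset.mem_univ, true_and]
    grind
  · intro σ hσ
    simp only [Finset.mem_filter] at hσ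
    exact Finset.mem_powerset.2 hσ.2.2

open Classical in
/-- Reciprocity between the paths crossing a spanning set of hyperplanes and all paths. -/
theorem sum_pathSeries_spanning [FiniteDimensional ℝ V] {α : ι → Module.Dual ℝ V}
    {s : Ch → ι → SignType} (h : IsChamberSystem α s) :
    (-1) ^ Module.finrank ℝ V * ∑ T : Finset ι with
        (⨅ i ∈ T, LinearMap.ker (α i)) = ⨅ i, LinearMap.ker (α i), pathSeries s T =
      (-1) ^ Module.finrank ℝ (⨅ i, LinearMap.ker (α i) : Submodule ℝ V) *
        (PowerSeries.X ^ Fintype.card ι * ∑ T : Finset ι, pathSeries s T) := by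
  have hzero : zeroSet (0 : ι → SignType) = Finset.univ := by ext; simp
  have hcov0 : IsCovector α 0 := ⟨0, fun i => by simp⟩
  -- A point of the face lies in the intersection of the hyperplanes in its zero set; if that is the
  -- center, every form vanishes there.
  have hflat : ∀ σ, IsCovector α σ →
      (⨅ i ∈ zeroSet σ, LinearMap.ker (α i)) = ⨅ i, LinearMap.ker (α i) → σ = 0 := by
    rintro σ ⟨v, hv⟩ heq
    have hmem : v ∈ ⨅ i ∈ zeroSet σ, LinearMap.ker (α i) := by
      rw [← flat_eq_iInf_zeroSet, mem_flat]
      intro i hi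
      rw [← sign_eq_zero_iff, hv, hi]
    rw [heq, Submodule.mem_iInf] at hmem
    funext i
    rw [← hv, Pi.zero_apply, sign_eq_zero_iff]
    exact hmem i
  -- A proper subset `T` that cuts out the center is the zero set of no covector, so its path series
  -- contributes nothing.
  rw [Finset.mul_sum, Finset.sum_congr rfl fun T _ => pathSeries_eq_sum_covector h T,
    Finset.sum_eq_single Finset.univ]
  · have hset : (Finset.univ.filter fun σ : ι → SignType =>
        IsCovector α σ ∧ zeroSet σ = Finset.univ) = {0} := by
      ext σ
      simp only [Finset.mem_filter, Finset.mem_univ, true_and, Finset.mem_singleton]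
      constructor
      · rintro ⟨hσ, hz⟩
        refine hflat σ hσ ?_
        rw [hz]
        simp
      · rintro rfl
        exact ⟨hcov0, hzero⟩
    rw [hset, Finset.sum_singleton, flat_eq_iInf_zeroSet, hzero]
    have hw : ∀ C, faceWeighting s 0 C = weighting s Finset.univ C := by
      intro C
      simp [faceWeighting, hzero]
    have hi : (⨅ i ∈ (Finset.univ : Finset ι), LinearMap.ker (α i)) = ⨅ i, LinearMap.ker (α i) := by
      simp
    rw [hi]
    simp only [hw, sum_weighting_eq s h.injective, Finset.powerset_univ, Finset.card_univ]
  · intro T hT hTu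
    refine Finset.sum_eq_zero fun σ hσ => ?_
    simp only [Finset.mem_filter, Finset.mem_univ, true_and] at hT hσ
    refine absurd ?_ hTu
    rw [← hσ.2, hflat σ hσ.1 (by rw [hσ.2, hT]), hzero]
  · intro hT
    simp at hT

end

end SignVector

/-! ### Tope graph distance equals the number of separating hyperplanes. -/

namespace SignVector

open scoped PowerSeries Matrix

section

variable {V : Type*} [AddCommGroup V] [Module ℝ V] [FiniteDimensional ℝ V] {ι : Type*}

theorem exists_ker_ne {f g : Module.Dual ℝ V} (hf : f ≠ 0) (hg : g ≠ 0)
    (h : LinearMap.ker f ≠ LinearMap.ker g) (a : SignType) (ha : a ≠ 0) :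
    ∃ v, SignType.sign (f v) = a ∧ g v = 0 := by
  have h' : ¬ LinearMap.ker g ≤ LinearMap.ker f := by
    intro hle
    refine h (Submodule.eq_of_le_of_finrank_eq hle ?_).symm
    have h1 := Module.Dual.finrank_ker_add_one_of_ne_zero hf
    have h2 := Module.Dual.finrank_ker_add_one_of_ne_zero hg
    omega
  obtain ⟨v, hv, hfv⟩ := Set.not_subset.1 h'
  have hfv : f v ≠ 0 := hfv
  have hv : g v = 0 := hv
  by_cases hs : SignType.sign (f v) = a
  · exact ⟨v, hs, hv⟩
  · refine ⟨-v, ?_, by rw [map_neg, hv, neg_zero]⟩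
    have hne : SignType.sign (f v) ≠ 0 := by rwa [Ne, sign_eq_zero_iff]
    rw [map_neg, Left.sign_neg]
    revert hne hs ha
    generalize SignType.sign (f v) = b
    revert a b
    decide

/-- Distinct hyperplanes do not contain one another, so the two signs can be prescribed by vectors
each lying on the other hyperplane, and then added. -/
theorem exists_isCovector_of_ker_ne {α : ι → Module.Dual ℝ V} (hα : ∀ i, α i ≠ 0)
    (hker : Function.Injective fun i => LinearMap.ker (α i)) {i j : ι} (hij : i ≠ j)
    {a b : SignType} (ha : a ≠ 0) (hb : b ≠ 0) :
    ∃ u, IsCovector α u ∧ u i = a ∧ u j = b := by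
  obtain ⟨v, hv, hv'⟩ := exists_ker_ne (hα i) (hα j) (fun h => hij (hker h)) a ha
  obtain ⟨w, hw, hw'⟩ := exists_ker_ne (hα j) (hα i) (fun h => hij (hker h.symm)) b hb
  exact ⟨fun k => SignType.sign (α k (v + w)), ⟨v + w, fun k => rfl⟩,
    by simp [hw', hv], by simp [hv', hw]⟩

variable [Fintype ι] {Ch : Type*}

theorem eq_of_ne_of_ne {a b c : SignType} (ha : a ≠ 0) (hb : b ≠ 0) (hc : c ≠ 0) (hab : a ≠ b)
    (hac : a ≠ c) : b = c := by
  have key : ∀ a b : SignType, a ≠ 0 → b ≠ 0 → a ≠ b → b = -a := by decide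
  rw [key a b ha hb hab, key a c ha hc hac]

/-- On a segment from `C` to `E`, take the point on hyperplane `i` and resolve the zeros of its sign
vector so that exactly one of `i`, `j` has been crossed. -/
theorem exists_between {α : ι → Module.Dual ℝ V} (hα : ∀ i, α i ≠ 0)
    (hker : Function.Injective fun i => LinearMap.ker (α i)) {s : Ch → ι → SignType}
    (h : IsChamberSystem α s) (C E : Ch) (hCE : 1 < (diff (s C) (s E)).card) :
    ∃ D, diff (s C) (s D) ⊂ diff (s C) (s E) ∧ C ≠ D := by
  obtain ⟨i, hi, j, hj, hij⟩ := Finset.one_lt_card.1 hCE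
  rw [mem_diff] at hi hj
  suffices hsuff : ∃ τ, IsCovector α τ ∧ (∀ k, s C k = s E k → τ k = s C k) ∧
      (∀ k, τ k ≠ 0) ∧ ((τ i = s C i ∧ τ j ≠ s C j) ∨ (τ j = s C j ∧ τ i ≠ s C i)) by
    obtain ⟨τ, hτ, hoff, hne, hor⟩ := hsuff
    obtain ⟨D, rfl⟩ := h.surj τ hτ hne
    have hsub : diff (s C) (s D) ⊆ diff (s C) (s E) := by
      intro k hk
      rw [mem_diff] at hk ⊢
      exact fun h' => hk (hoff k h').symm
    rcases hor with ⟨h1, h2⟩ | ⟨h1, h2⟩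
    · refine ⟨D, (Finset.ssubset_iff_of_subset hsub).2 ⟨i, (mem_diff _ _ _).2 hi, ?_⟩, ?_⟩
      · simp [h1]
      · rintro rfl
        exact h2 rfl
    · refine ⟨D, (Finset.ssubset_iff_of_subset hsub).2 ⟨j, (mem_diff _ _ _).2 hj, ?_⟩, ?_⟩
      · simp [h1]
      · rintro rfl
        exact h2 rfl
  obtain ⟨p, hp⟩ := h.isCovector C
  obtain ⟨e, he⟩ := h.isCovector E
  -- The form `α i` has opposite signs at `p` and `e`, so these weights make it vanish at `z`.
  set z : V := |α i e| • p + |α i p| • e with hz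
  set ζ : ι → SignType := fun k => SignType.sign (α k z) with hζ
  have hζc : IsCovector α ζ := ⟨z, fun _ => rfl⟩
  have hp0 : α i p ≠ 0 := by
    rw [Ne, ← sign_eq_zero_iff, hp]
    exact h.ne_zero C i
  have hζi : ζ i = 0 := by
    have h1 := h.ne_zero C i
    have h2 := h.ne_zero E i
    rw [← hp, Ne, sign_eq_zero_iff] at h1
    rw [← he, Ne, sign_eq_zero_iff] at h2
    rw [← hp, ← he] at hi
    simp only [hζ, hz, map_add, map_smul, smul_eq_mul, sign_eq_zero_iff]
    rcases lt_or_gt_of_ne h1 with g1 | g1 <;> rcases lt_or_gt_of_ne h2 with g2 | g2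
    · rw [sign_neg g1, sign_neg g2] at hi
      exact absurd rfl hi
    · rw [abs_of_neg g1, abs_of_pos g2]; ring
    · rw [abs_of_pos g1, abs_of_neg g2]; ring
    · rw [sign_pos g1, sign_pos g2] at hi
      exact absurd rfl hi
  have hoff : ∀ k, s C k = s E k → ζ k = s C k := by
    intro k hk
    simp only [hζ, hz, map_add, map_smul, smul_eq_mul]
    rw [sign_add_eq (by rw [hp, he, hk]) (abs_nonneg _) (abs_nonneg _)
      (add_pos_of_nonneg_of_pos (abs_nonneg _) (abs_pos.2 hp0)), hp]
  have hoff' : ∀ τ, ∀ k, s C k = s E k → comp ζ τ k = s C k := by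
    intro τ k hk
    rw [comp, hoff k hk, if_neg (h.ne_zero C k)]
  have hne : ∀ σ : ι → SignType, ∀ D, ∀ k, comp σ (s D) k ≠ 0 := by
    intro σ D k
    rw [comp]
    split_ifs with h0
    · exact h.ne_zero D k
    · exact h0
  by_cases hj0 : ζ j = 0
  -- The segment meets hyperplanes `i` and `j` at the same point: `u` perturbs it to the side of `C`
  -- at `i` and of `E` at `j`.
  · obtain ⟨u, hu, hui, huj⟩ := exists_isCovector_of_ker_ne hα hker hij (h.ne_zero C i)
      (h.ne_zero E j)
    refine ⟨comp (comp ζ u) (s C), (hζc.comp hu).comp (h.isCovector C), fun k hk => ?_, hne _ C,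
      Or.inl ⟨?_, ?_⟩⟩
    · rw [comp, hoff' u k hk, if_neg (h.ne_zero C k)]
    · simp [comp, hζi, hui]
    · simp [comp, hj0, huj, h.ne_zero E j, Ne.symm hj]
  · by_cases hj1 : ζ j = s C j
    · refine ⟨comp ζ (s E), hζc.comp (h.isCovector E), hoff' _, hne _ E, Or.inr ⟨?_, ?_⟩⟩
      · rw [comp, if_neg hj0, hj1]
      · rw [comp, if_pos hζi]
        exact Ne.symm hi
    · refine ⟨comp ζ (s C), hζc.comp (h.isCovector C), hoff' _, hne _ C, Or.inl ⟨?_, ?_⟩⟩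
      · rw [comp, if_pos hζi]
      · rw [comp, if_neg hj0]
        exact hj1

theorem exists_adjacent {α : ι → Module.Dual ℝ V} (hα : ∀ i, α i ≠ 0)
    (hker : Function.Injective fun i => LinearMap.ker (α i)) {s : Ch → ι → SignType}
    (h : IsChamberSystem α s) (C : Ch) : ∀ (n : ℕ) (E : Ch), (diff (s C) (s E)).card = n → C ≠ E →
    ∃ D, diff (s C) (s D) ⊆ diff (s C) (s E) ∧ (diff (s C) (s D)).card = 1 := by
  intro n
  induction n using Nat.strong_induction_on with
  | _ n ih =>
    intro E hn hCE
    have hpos : 0 < (diff (s C) (s E)).card := by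
      rw [Finset.card_pos, Finset.nonempty_iff_ne_empty, Ne, diff_eq_empty]
      exact fun h' => hCE (h.injective h')
    by_cases h1 : (diff (s C) (s E)).card = 1
    · exact ⟨E, subset_rfl, h1⟩
    · obtain ⟨D, hD, hCD⟩ := exists_between hα hker h C E (by omega)
      obtain ⟨D', h2, h3⟩ := ih _ (hn ▸ Finset.card_lt_card hD) D rfl hCD
      exact ⟨D', h2.trans hD.1, h3⟩

theorem diff_subset_union [DecidableEq ι] (σ τ υ : ι → SignType) :
    diff σ υ ⊆ diff σ τ ∪ diff τ υ := by
  intro i hi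
  rw [Finset.mem_union, mem_diff, mem_diff]
  rw [mem_diff] at hi
  by_contra! h'
  exact hi (h'.1.trans h'.2)

/-- The distance in the tope graph is the number of separating hyperplanes. -/
theorem edist_eq_card_diff {α : ι → Module.Dual ℝ V} (hα : ∀ i, α i ≠ 0)
    (hker : Function.Injective fun i => LinearMap.ker (α i)) {s : Ch → ι → SignType}
    (h : IsChamberSystem α s) (G : SimpleGraph Ch)
    (hG : ∀ C D, G.Adj C D ↔ (diff (s C) (s D)).card = 1) (C D : Ch) :
    G.edist C D = (diff (s C) (s D)).card := by
  classical
  apply le_antisymm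
  · induction hn : (diff (s C) (s D)).card generalizing C with
    | zero =>
      rw [Finset.card_eq_zero, diff_eq_empty] at hn
      rw [h.injective hn, SimpleGraph.edist_self]
      simp
    | succ n ih =>
      have hCD : C ≠ D := by
        rintro rfl
        rw [diff_self] at hn
        simp at hn
      -- Upper bound: a neighbour of `C` across one of the separating hyperplanes is one crossing
      -- closer to `D`.
      obtain ⟨E, hE, hE1⟩ := exists_adjacent hα hker h C _ D rfl hCD
      have hdiff : diff (s E) (s D) = diff (s C) (s D) \ diff (s C) (s E) := by
        ext i
        rw [Finset.mem_sdiff, mem_diff, mem_diff, mem_diff]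
        by_cases hi : s C i = s E i
        · simp [hi]
        · have hiD : s C i ≠ s D i := (mem_diff _ _ _).1 (hE ((mem_diff _ _ _).2 hi))
          have := eq_of_ne_of_ne (h.ne_zero C i) (h.ne_zero E i) (h.ne_zero D i) hi hiD
          simp [this]
      have hcard : (diff (s E) (s D)).card = n := by
        rw [hdiff, Finset.card_sdiff_of_subset hE, hn, hE1, Nat.add_sub_cancel]
      calc G.edist C D ≤ G.edist C E + G.edist E D := SimpleGraph.edist_triangle
        _ ≤ 1 + n := add_le_add (SimpleGraph.edist_eq_one_iff_adj.2 ((hG C E).2 hE1)).le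
            (ih E hcard)
        _ = _ := by push_cast; rw [add_comm]
  -- Lower bound: each edge of a walk changes only one sign.
  · refine le_iInf fun p => ?_
    rw [Nat.cast_le]
    induction p with
    | nil => simp [diff_self]
    | @cons u v w hadj p ih =>
      rw [SimpleGraph.Walk.length_cons]
      refine (Finset.card_le_card (diff_subset_union _ (s v) _)).trans
        ((Finset.card_union_le _ _).trans ?_)
      rw [(hG _ _).1 hadj]
      omega

/-! ### Euler characteristics as coefficients of path series. -/

open GraphMagnitude

/-- At a smooth vertex the cardinalities of the two separating sets add up, so their union is the
separating set of the shortcut. Hence any condition on the crossed set defines a subcomplex. -/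
theorem cross_deleteVertex {s : Ch → ι → SignType} {G : SimpleGraph Ch}
    (hG : ∀ C D, G.edist C D = (diff (s C) (s D)).card) {k : ℕ} (x : Fin (k + 2) → Ch) (i : Fin k)
    (h : IsSmooth G x i) : cross s (deleteVertex x i) = cross s x := by
  classical
  unfold IsSmooth at h
  simp only [hG] at h
  norm_cast at h
  set a := s (x i.castSucc.castSucc)
  set b := s (x i.succ.castSucc)
  set c := s (x i.succ.succ)
  have hun : diff a c = diff a b ∪ diff b c :=
    Finset.eq_of_subset_of_card_le (diff_subset_union a b c) (h ▸ Finset.card_union_le _ _)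
  have hi : diff (s (deleteVertex x i i.castSucc)) (s (deleteVertex x i i.succ)) =
      diff a b ∪ diff b c := by
    rw [deleteVertex_of_le x i i.castSucc (by simp), deleteVertex_of_lt x i i.succ (by simp)]
    exact hun
  have hsucc : i.castSucc.succAbove i = i.succ := Fin.succAbove_of_le_castSucc _ _ le_rfl
  ext j
  simp only [cross, Finset.mem_biUnion, Finset.mem_univ, true_and]
  rw [Fin.exists_iff_succAbove i.castSucc]
  constructor
  · rintro ⟨m, hm⟩
    by_cases hmi : m = i
    · subst hmi
      rw [hi, Finset.mem_union] at hm
      refine hm.imp id fun hm => ⟨m, ?_⟩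
      rw [hsucc]
      exact hm
    · have := deleteVertex_castSucc_and_succ x hmi
      rw [this.1, this.2] at hm
      exact Or.inr ⟨m, hm⟩
  · rintro (hm | ⟨m, hm⟩)
    · refine ⟨i, ?_⟩
      rw [hi]
      exact Finset.mem_union_left _ hm
    · by_cases hmi : m = i
      · subst hmi
        refine ⟨m, ?_⟩
        rw [hi]
        rw [hsucc] at hm
        exact Finset.mem_union_right _ hm
      · refine ⟨m, ?_⟩
        have := deleteVertex_castSucc_and_succ x hmi
        rwa [this.1, this.2]

theorem length_eq_pathLength {s : Ch → ι → SignType} {G : SimpleGraph Ch}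
    (hG : ∀ C D, G.edist C D = (diff (s C) (s D)).card) {k : ℕ} (x : Fin (k + 1) → Ch) :
    length G x = pathLength s x := by
  simp [length, pathLength, hG]

open Classical in
-- Serves both complexes: a trivial `Q` gives the full one, the center condition the interior one.
-- Length `l` bounds the degree, so Euler–Poincaré applies and the basis is counted by crossed set.
theorem eulerChar_supported [Fintype Ch] {s : Ch → ι → SignType} {G : SimpleGraph Ch}
    (hG : ∀ C D, G.edist C D = (diff (s C) (s D)).card) (Q : Finset ι → Prop) (l : ℕ) :
    (eulerChar G (fun k => Finsupp.supported ℤ ℤ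
      {x : Fin (k + 1) → Ch | x ∈ properChains G k l ∧ Q (cross s x)}) : ℚ) =
      PowerSeries.coeff l (∑ T : Finset ι with Q T, pathSeries s T) := by
  rw [eulerChar_eq_sum_finrank G (fun a b => by rw [hG]; exact ENat.natCast_ne_top _) _ ?_ l ?_]
  · simp only [map_sum, pathSeries, PowerSeries.coeff_mk]
    rw [Finset.sum_comm]
    push_cast
    refine Finset.sum_congr rfl fun k _ => ?_
    rw [← Finset.mul_sum, finrank_supported]
    congr 1
    have hset : {x : Fin (k + 1) → Ch | x ∈ properChains G k l ∧ Q (cross s x)} =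
        ((Finset.univ.filter Q).biUnion fun T => paths s k l T : Finset (Fin (k + 1) → Ch)) := by
      ext x
      simp only [Set.mem_ofPred_eq, Finset.coe_biUnion, Set.mem_iUnion, Finset.mem_coe,
        Finset.mem_filter, Finset.mem_univ, true_and, paths, properChains,
        length_eq_pathLength hG, Nat.cast_inj]
      grind
    rw [hset, Set.ncard_coe_finset, Finset.card_biUnion]
    · push_cast
      rfl
    · intro T _ T' _ hTT'
      rw [Function.onFun, Finset.disjoint_left]
      intro x hx hx'
      simp only [paths, Finset.mem_filter] at hx hx'
      exact hTT' (hx.2.2.2.symm.trans hx'.2.2.2)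
  · intro k
    refine map_boundary_supported_le G _ _ fun x hx i hi =>
      ⟨deleteVertex_mem_properChains G x hx.1 i hi, ?_⟩
    rw [cross_deleteVertex hG x i hi]
    exact hx.2
  · intro k hk
    have : {x : Fin (k + 1) → Ch | x ∈ properChains G k l ∧ Q (cross s x)} = ∅ := by
      refine Set.eq_empty_of_forall_notMem fun x hx => ?_
      have := le_of_mem_properChains G x hx.1
      omega
    rw [this, Finsupp.supported_empty]

end

end SignVector

/-! ### Rational functions: expansion at zero and the substitution `q ↦ q⁻¹`. -/

namespace SignVector

open GraphMagnitude

open scoped PowerSeries Matrix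

section

open scoped RatFunc in
/-- The embedding of the rational functions into the Laurent series. -/
noncomputable def ratFuncToLaurent (F : Type*) [Field F] : RatFunc F →+* LaurentSeries F :=
  algebraMap (RatFunc F) (LaurentSeries F)

open scoped RatFunc in
theorem ratFuncToLaurent_X (F : Type*) [Field F] :
    ratFuncToLaurent F RatFunc.X = HahnSeries.ofPowerSeries ℤ F PowerSeries.X := by
  rw [ratFuncToLaurent, RatFunc.coe_X, PowerSeries.coe_X]

variable {ι : Type*} [Fintype ι] {Ch : Type*}

theorem zetaMatrix_apply {s : Ch → ι → SignType} {G : SimpleGraph Ch}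
    (hG : ∀ C D, G.edist C D = (diff (s C) (s D)).card) (C D : Ch) :
    zetaMatrix G C D = RatFunc.X ^ (diff (s C) (s D)).card := by
  rw [zetaMatrix, Matrix.of_apply, if_neg (by rw [hG]; exact ENat.natCast_ne_top _),
    SimpleGraph.dist, hG, ENat.toNat_natCast]

theorem zetaMatrix_map {s : Ch → ι → SignType} {G : SimpleGraph Ch}
    (hG : ∀ C D, G.edist C D = (diff (s C) (s D)).card) :
    (zetaMatrix G).map (ratFuncToLaurent ℚ) =
      (zeta s Finset.univ).map (HahnSeries.ofPowerSeries ℤ ℚ) := by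
  ext1 C D
  rw [Matrix.map_apply, Matrix.map_apply, zetaMatrix_apply hG, zeta, Matrix.of_apply,
    if_pos (Finset.subset_univ _), map_pow, map_pow, ratFuncToLaurent_X]

variable [Fintype Ch]

open Classical in
-- Transports inverse matrices, both to Laurent series and along `q ↦ q⁻¹`, once an inverse of the
-- image is exhibited.
theorem map_eq_of_mul_eq_one {R S : Type*} [CommRing R] [CommRing S] (f : R →+* S)
    {M W : Matrix Ch Ch R} {N : Matrix Ch Ch S} (hMW : M * W = 1) (hN : M.map f * N = 1) :
    W.map f = N := by
  have h : M.map f * W.map f = 1 := by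
    rw [← Matrix.map_mul, hMW]
    simp
  have h' := mul_eq_one_comm.1 h
  calc W.map f = W.map f * (M.map f * N) := by rw [hN, mul_one]
    _ = N := by rw [← mul_assoc, h', one_mul]

open Classical in
theorem isUnit_det_zetaMatrix {s : Ch → ι → SignType} (hs : Function.Injective s)
    {G : SimpleGraph Ch} (hG : ∀ C D, G.edist C D = (diff (s C) (s D)).card) :
    IsUnit (zetaMatrix G).det := by
  rw [isUnit_iff_ne_zero]
  intro h0
  have h := congrArg (ratFuncToLaurent ℚ) h0
  rw [RingHom.map_det, RingHom.mapMatrix_apply, zetaMatrix_map hG, ← RingHom.mapMatrix_apply,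
    ← RingHom.map_det, map_zero] at h
  exact ((isUnit_det_zeta s hs Finset.univ).map (HahnSeries.ofPowerSeries ℤ ℚ)).ne_zero h

open Classical in
theorem ratFuncToLaurent_mag {s : Ch → ι → SignType} (hs : Function.Injective s)
    {G : SimpleGraph Ch} (hG : ∀ C D, G.edist C D = (diff (s C) (s D)).card) :
    ratFuncToLaurent ℚ (mag G) = HahnSeries.ofPowerSeries ℤ ℚ (∑ T, pathSeries s T) := by
  have hinv := map_eq_of_mul_eq_one (ratFuncToLaurent ℚ) (M := zetaMatrix G) (W := (zetaMatrix G)⁻¹)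
    (N := (zeta s Finset.univ)⁻¹.map (HahnSeries.ofPowerSeries ℤ ℚ))
    (Matrix.mul_nonsing_inv _ (isUnit_det_zetaMatrix hs hG)) (by
      rw [zetaMatrix_map hG, ← Matrix.map_mul,
        Matrix.mul_nonsing_inv _ (isUnit_det_zeta s hs Finset.univ)]
      simp)
  have hsum := sum_weighting_eq s hs Finset.univ
  rw [Finset.powerset_univ] at hsum
  rw [← hsum, mag, map_sum, map_sum]
  refine Finset.sum_congr rfl fun C _ => ?_
  change _ = HahnSeries.ofPowerSeries ℤ ℚ (∑ D, (zeta s Finset.univ)⁻¹ C D * 1)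
  rw [map_sum, map_sum]
  refine Finset.sum_congr rfl fun D _ => ?_
  rw [mul_one]
  exact congrFun (congrFun hinv C) D

/-- `X⁻¹` is transcendental, since otherwise `X` would be algebraic. Thus no denominator is sent to
zero and the substitution is a ring homomorphism on all of `RatFunc F`. -/
theorem eval₂_inv_X_injective (F : Type*) [Field F] :
    Function.Injective (Polynomial.eval₂RingHom (RatFunc.C (K := F)) (RatFunc.X)⁻¹) := by
  rw [injective_iff_map_eq_zero]
  intro p hp
  by_contra hne
  refine RatFunc.transcendental_X (K := F) ?_
  have : IsAlgebraic F ((RatFunc.X : RatFunc F)⁻¹) := ⟨p, hne, hp⟩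
  simpa using this.inv

/-- The substitution `q ↦ q⁻¹`. -/
noncomputable def invertX (F : Type*) [Field F] : RatFunc F →+* RatFunc F :=
  RatFunc.liftRingHom (Polynomial.eval₂RingHom (RatFunc.C (K := F)) (RatFunc.X)⁻¹)
    (nonZeroDivisors_le_comap_nonZeroDivisors_of_injective _ (eval₂_inv_X_injective F))

theorem invertX_apply {F : Type*} [Field F] (f : RatFunc F) :
    invertX F f = f.eval RatFunc.C (RatFunc.X)⁻¹ :=
  RatFunc.liftRingHom_apply _ _ f

theorem card_diff_neg {σ τ : ι → SignType} (hσ : ∀ i, σ i ≠ 0) (hτ : ∀ i, τ i ≠ 0) :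
    (diff σ τ).card + (diff σ (-τ)).card = Fintype.card ι := by
  classical
  have : diff σ (-τ) = (diff σ τ)ᶜ := by
    ext i
    have key : ∀ a b : SignType, a ≠ 0 → b ≠ 0 → (a ≠ -b ↔ ¬ a ≠ b) := by decide
    rw [Finset.mem_compl, mem_diff, mem_diff]
    exact key _ _ (hσ i) (hτ i)
  rw [this, Finset.card_add_card_compl]

open Classical in
/-- Substituting `q⁻¹` into the magnitude of a graph with antipodes. -/
theorem invertX_mag {s : Ch → ι → SignType} (hs : Function.Injective s)
    {G : SimpleGraph Ch} (hG : ∀ C D, G.edist C D = (diff (s C) (s D)).card)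
    (hs0 : ∀ C i, s C i ≠ 0) (hneg : ∀ C, ∃ D, s D = -s C) :
    invertX ℚ (mag G) = RatFunc.X ^ Fintype.card ι * mag G := by
  choose a ha using hneg
  have hinvol : Function.Involutive a := fun C => hs (by rw [ha, ha, neg_neg])
  set e : Ch ≃ Ch := hinvol.toPerm
  -- With `Z = zetaMatrix G` and `P` the antipodal permutation matrix, the substitution turns `Z`
  -- into `q^(-n) Z P`. Its inverse is `q^n` times `Z⁻¹` with rows permuted, and the permutation
  -- does not affect the sum of entries.
  have hinv := map_eq_of_mul_eq_one (invertX ℚ) (M := zetaMatrix G) (W := (zetaMatrix G)⁻¹)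
    (N := (RatFunc.X ^ Fintype.card ι : RatFunc ℚ) • (zetaMatrix G)⁻¹.submatrix e id)
    (Matrix.mul_nonsing_inv _ (isUnit_det_zetaMatrix hs hG)) (by
      rw [← Matrix.mul_nonsing_inv _ (isUnit_det_zetaMatrix hs hG)]
      ext1 C D
      rw [Matrix.mul_apply, Matrix.mul_apply, ← e.sum_comp]
      refine Finset.sum_congr rfl fun E _ => ?_
      rw [Matrix.map_apply, Matrix.smul_apply, Matrix.submatrix_apply, smul_eq_mul, ← mul_assoc]
      refine congrArg₂ _ ?_ (congrArg (fun E' => (zetaMatrix G)⁻¹ E' D) (hinvol E))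
      rw [zetaMatrix_apply hG, zetaMatrix_apply hG, map_pow, invertX_apply, RatFunc.eval_X]
      have hea : s (e E) = - s E := ha E
      rw [hea, ← card_diff_neg (hs0 C) (hs0 E), pow_add,
        inv_pow, mul_comm (RatFunc.X ^ (diff (s C) (s E)).card),
        inv_mul_cancel_left₀ (pow_ne_zero _ RatFunc.X_ne_zero)])
  rw [mag, map_sum, Finset.mul_sum, ← e.sum_comp]
  have hterm : ∀ C D, invertX ℚ ((zetaMatrix G)⁻¹ C D) =
      RatFunc.X ^ Fintype.card ι * (zetaMatrix G)⁻¹ (e C) D := fun C D =>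
    congrFun (congrFun hinv C) D
  refine Finset.sum_congr rfl fun C _ => ?_
  have hee : e (e C) = C := hinvol C
  rw [map_sum, Finset.mul_sum]
  refine Finset.sum_congr rfl fun D _ => ?_
  rw [hterm, hee]

end

end SignVector

/-! ### Chambers of an arrangement as sign vectors. -/

namespace Arrangement

open SignVector GraphMagnitude

open scoped PowerSeries Matrix

section

variable {d : ℕ} (A : Arrangement d)

/-- A linear form defining a member of the arrangement. -/
noncomputable def form (H : A.hyperplanes) : Module.Dual ℝ (EuclideanSpace ℝ (Fin d)) :=
  (A.exists_form H.1 H.2).choose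

theorem form_ne_zero (H : A.hyperplanes) : A.form H ≠ 0 :=
  (A.exists_form H.1 H.2).choose_spec.1

theorem ker_form (H : A.hyperplanes) : LinearMap.ker (A.form H) = H.1 :=
  (A.exists_form H.1 H.2).choose_spec.2

theorem mem_iff_form_eq_zero (H : A.hyperplanes) (x : EuclideanSpace ℝ (Fin d)) :
    x ∈ H.1 ↔ A.form H x = 0 := by
  rw [← ker_form, LinearMap.mem_ker]

theorem mem_complement_iff (x : EuclideanSpace ℝ (Fin d)) :
    x ∈ A.complement ↔ ∀ H, A.form H x ≠ 0 := by
  constructor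
  · exact fun h H h0 => h H.1 H.2 ((A.mem_iff_form_eq_zero H x).2 h0)
  · exact fun h H hH hx => h ⟨H, hH⟩ ((A.mem_iff_form_eq_zero ⟨H, hH⟩ x).1 hx)

/-- A point of a chamber. -/
noncomputable def point (C : A.Chamber) : EuclideanSpace ℝ (Fin d) := C.2.choose

theorem point_mem_complement (C : A.Chamber) : A.point C ∈ A.complement := C.2.choose_spec.1

theorem eq_connectedComponentIn_point (C : A.Chamber) :
    C.1 = connectedComponentIn A.complement (A.point C) := C.2.choose_spec.2

theorem point_mem (C : A.Chamber) : A.point C ∈ C.1 := by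
  rw [eq_connectedComponentIn_point]
  exact mem_connectedComponentIn (A.point_mem_complement C)

/-- The sign vector of a chamber. -/
noncomputable def signs (C : A.Chamber) (H : A.hyperplanes) : SignType :=
  SignType.sign (A.form H (A.point C))

theorem not_neg_and_pos_of_isPreconnected {S : Set (EuclideanSpace ℝ (Fin d))}
    (hS : IsPreconnected S) (hSA : S ⊆ A.complement) {x y : EuclideanSpace ℝ (Fin d)}
    (hx : x ∈ S) (hy : y ∈ S) (H : A.hyperplanes) (h1 : A.form H x < 0) : A.form H y < 0 := by
  by_contra h2
  have hcont : Continuous (A.form H) := LinearMap.continuous_of_finiteDimensional _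
  obtain ⟨z, hz, h0⟩ := hS.intermediate_value hx hy hcont.continuousOn
    (show (0 : ℝ) ∈ Set.Icc _ _ from ⟨h1.le, not_lt.1 h2⟩)
  exact (A.mem_complement_iff z).1 (hSA hz) H h0

theorem sign_form_eq_signs {C : A.Chamber} {x : EuclideanSpace ℝ (Fin d)} (hx : x ∈ C.1)
    (H : A.hyperplanes) : SignType.sign (A.form H x) = A.signs C H := by
  have hpre : IsPreconnected C.1 := by
    rw [eq_connectedComponentIn_point]
    exact isPreconnected_connectedComponentIn
  have hsub : C.1 ⊆ A.complement := by
    rw [eq_connectedComponentIn_point]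
    exact connectedComponentIn_subset _ _
  have hp := A.point_mem C
  have h1 := (A.mem_complement_iff x).1 (hsub hx) H
  have h2 := (A.mem_complement_iff _).1 (A.point_mem_complement C) H
  rw [signs]
  rcases lt_or_gt_of_ne h1 with h | h
  · rw [sign_neg h, sign_neg (A.not_neg_and_pos_of_isPreconnected hpre hsub hx hp H h)]
  · rcases lt_or_gt_of_ne h2 with h' | h'
    · exact absurd (A.not_neg_and_pos_of_isPreconnected hpre hsub hp hx H h') (not_lt.2 h.le)
    · rw [sign_pos h, sign_pos h']

/-- Points with given nonzero signs form a convex subset of the complement, hence lie in a single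
component. -/
theorem signs_injective : Function.Injective A.signs := by
  intro C D h
  set S : Set (EuclideanSpace ℝ (Fin d)) :=
    {x | ∀ H, SignType.sign (A.form H x) = A.signs C H} with hS
  have hconv : Convex ℝ S := by
    intro v hv w hw a b ha hb hab H
    rw [map_add, map_smul, map_smul, smul_eq_mul, smul_eq_mul,
      sign_add_eq ((hv H).trans (hw H).symm) ha hb (by linarith), hv H]
  have hC : A.point C ∈ S := fun H => rfl
  have hD : A.point D ∈ S := fun H => (congrFun h H).symm
  have hsub : S ⊆ A.complement := by
    intro x hx
    rw [mem_complement_iff]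
    intro H h0
    have h1 := hx H
    rw [h0, sign_zero, eq_comm, signs, sign_eq_zero_iff] at h1
    exact (A.mem_complement_iff _).1 (A.point_mem_complement C) H h1
  have hmem := hconv.isPreconnected.subset_connectedComponentIn hC hsub hD
  apply Subtype.ext
  rw [eq_connectedComponentIn_point, eq_connectedComponentIn_point]
  exact connectedComponentIn_eq hmem

theorem isChamberSystem : IsChamberSystem A.form A.signs where
  injective := A.signs_injective
  isCovector C := ⟨A.point C, fun _ => rfl⟩
  ne_zero C H := by
    rw [signs, Ne, sign_eq_zero_iff]
    exact (A.mem_complement_iff _).1 (A.point_mem_complement C) H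
  surj := by
    rintro σ ⟨v, hv⟩ hσ
    have hvc : v ∈ A.complement := by
      rw [mem_complement_iff]
      intro H
      rw [Ne, ← sign_eq_zero_iff, hv]
      exact hσ H
    refine ⟨⟨connectedComponentIn A.complement v, v, hvc, rfl⟩, funext fun H => ?_⟩
    rw [← hv]
    exact (A.sign_form_eq_signs (mem_connectedComponentIn hvc) H).symm

theorem ker_form_injective : Function.Injective fun H => LinearMap.ker (A.form H) := by
  intro H K h
  simp only [ker_form] at h
  exact Subtype.ext h

theorem separates_iff (C D : A.Chamber) (H : A.hyperplanes) :
    Separates H.1 C.1 D.1 ↔ A.signs C H ≠ A.signs D H := by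
  have hC0 := A.isChamberSystem.ne_zero C H
  have hD0 := A.isChamberSystem.ne_zero D H
  constructor
  · rintro ⟨β, hβ, hC, hD⟩ heq
    have h1 := hC _ (A.point_mem C)
    have h2 := hD _ (A.point_mem D)
    -- The positive weights place `z` on the hyperplane; equal signs of `A.form H` at both points
    -- would keep it off.
    set z := (-β (A.point D)) • A.point C + β (A.point C) • A.point D with hz
    have hβz : β z = 0 := by
      rw [hz, map_add, map_smul, map_smul, smul_eq_mul, smul_eq_mul]
      ring
    have hz0 : A.form H z = 0 := by
      rw [← mem_iff_form_eq_zero, ← hβ]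
      exact hβz
    have := sign_add_eq (show SignType.sign (A.form H (A.point C)) =
      SignType.sign (A.form H (A.point D)) from heq) (neg_nonneg.2 h2.le) h1.le (by linarith)
    rw [hz, map_add, map_smul, map_smul, smul_eq_mul, smul_eq_mul] at hz0
    rw [hz0, sign_zero] at this
    exact hC0 this.symm
  · intro hne
    have key : ∀ a b : SignType, a ≠ 0 → b ≠ 0 → a ≠ b → (a = 1 ∧ b = -1) ∨ (a = -1 ∧ b = 1) := by
      decide
    rcases key _ _ hC0 hD0 hne with ⟨h1, h2⟩ | ⟨h1, h2⟩
    · refine ⟨A.form H, A.ker_form H, fun x hx => ?_, fun y hy => ?_⟩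
      · rw [← sign_eq_one_iff, A.sign_form_eq_signs hx, h1]
      · rw [← sign_eq_neg_one_iff, A.sign_form_eq_signs hy, h2]
    · refine Separates.symm ⟨A.form H, A.ker_form H, fun x hx => ?_, fun y hy => ?_⟩
      · rw [← sign_eq_one_iff, A.sign_form_eq_signs hx, h2]
      · rw [← sign_eq_neg_one_iff, A.sign_form_eq_signs hy, h1]

theorem sep_eq_image_diff (C D : A.Chamber) :
    A.sep C D = Subtype.val '' (diff (A.signs C) (A.signs D) : Set A.hyperplanes) := by
  ext H
  constructor
  · rintro ⟨hH, h⟩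
    exact ⟨⟨H, hH⟩, (mem_diff _ _ _).2 ((A.separates_iff C D ⟨H, hH⟩).1 h), rfl⟩
  · rintro ⟨H, h, rfl⟩
    exact ⟨H.2, (A.separates_iff C D H).2 ((mem_diff _ _ _).1 h)⟩

theorem topeGraph_adj_iff (C D : A.Chamber) :
    A.topeGraph.Adj C D ↔ (diff (A.signs C) (A.signs D)).card = 1 := by
  change (∃ H, A.sep C D = {H}) ↔ _
  rw [← Set.ncard_eq_one, sep_eq_image_diff,
    Set.ncard_image_of_injective _ Subtype.val_injective, Set.ncard_coe_finset]

theorem topeGraph_edist (C D : A.Chamber) :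
    A.topeGraph.edist C D = (diff (A.signs C) (A.signs D)).card :=
  edist_eq_card_diff A.form_ne_zero A.ker_form_injective A.isChamberSystem _ A.topeGraph_adj_iff C D

theorem crossed_eq_image_cross {k : ℕ} (x : Fin (k + 1) → A.Chamber) :
    A.crossed x = Subtype.val '' (cross A.signs x : Set A.hyperplanes) := by
  simp only [crossed, sep_eq_image_diff, cross, Finset.coe_biUnion, Set.image_iUnion]
  simp

theorem center_eq_iInf_ker : A.center = ⨅ H, LinearMap.ker (A.form H) := by
  simp only [ker_form, center, sInf_eq_iInf']
  rfl

theorem sInf_image_eq_iInf_ker (T : Finset A.hyperplanes) :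
    sInf (Subtype.val '' (T : Set A.hyperplanes)) = ⨅ H ∈ T, LinearMap.ker (A.form H) := by
  simp only [sInf_image, ker_form, Finset.mem_coe]

/-- Every path has exactly one crossed set, so the supremum over `B` is the span of a single set of
basis paths. -/
theorem interiorChains_eq_supported (l k : ℕ) :
    A.interiorChains l k = Finsupp.supported ℤ ℤ {x : Fin (k + 1) → A.Chamber |
      x ∈ properChains A.topeGraph k l ∧
        (⨅ H ∈ cross A.signs x, LinearMap.ker (A.form H)) = ⨅ H, LinearMap.ker (A.form H)} := by
  refine le_antisymm (iSup₂_le ?_) ?_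
  · rintro B ⟨-, hB⟩
    refine Finsupp.supported_mono ?_
    rintro x ⟨hx, rfl⟩
    rw [crossed_eq_image_cross, sInf_image_eq_iInf_ker, center_eq_iInf_ker] at hB
    exact ⟨hx, hB⟩
  · rw [Finsupp.supported_eq_span_single, Submodule.span_le]
    rintro _ ⟨x, ⟨hx, h⟩, rfl⟩
    refine Submodule.mem_iSup_of_mem (A.crossed x) (Submodule.mem_iSup_of_mem ⟨?_, ?_⟩
      (Finsupp.single_mem_supported ℤ _ ⟨hx, rfl⟩))
    · rw [crossed_eq_image_cross]
      rintro _ ⟨H, -, rfl⟩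
      exact H.2
    · rw [crossed_eq_image_cross, sInf_image_eq_iInf_ker, center_eq_iInf_ker, h]

open Classical in
theorem interiorEulerChar_eq_coeff (l : ℕ) :
    (A.interiorEulerChar l : ℚ) = PowerSeries.coeff l (∑ T : Finset A.hyperplanes with
      (⨅ H ∈ T, LinearMap.ker (A.form H)) = ⨅ H, LinearMap.ker (A.form H),
      pathSeries A.signs T) := by
  refine Eq.trans ?_ (eulerChar_supported A.topeGraph_edist (fun T =>
    (⨅ H ∈ T, LinearMap.ker (A.form H)) = ⨅ H, LinearMap.ker (A.form H)) l)
  rw [interiorEulerChar]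
  congr 2
  funext k
  exact A.interiorChains_eq_supported l k

theorem magEulerChar_eq_coeff (l : ℕ) :
    open Classical in (A.magEulerChar l : ℚ) =
      PowerSeries.coeff l (∑ T : Finset A.hyperplanes, pathSeries A.signs T) := by
  classical
  have h := eulerChar_supported A.topeGraph_edist (fun _ => True) l
  simp only [and_true, Set.ofPred_mem_eq, Finset.filter_true] at h
  exact h

theorem finrank_center_add_rank : A.rank + Module.finrank ℝ A.center =
    Module.finrank ℝ (EuclideanSpace ℝ (Fin d)) :=
  Submodule.finrank_quotient_add_finrank _

open Classical in
/-- Reciprocity between the generating series of the interior and the ordinary Euler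
characteristics. -/
theorem mk_interiorEulerChar :
    (PowerSeries.mk fun l => (A.interiorEulerChar l : ℚ)) =
      (-1) ^ A.rank *
        (PowerSeries.X ^ A.card * ∑ T : Finset A.hyperplanes, pathSeries A.signs T) := by
  have h := sum_pathSeries_spanning A.isChamberSystem
  have hI : (PowerSeries.mk fun l => (A.interiorEulerChar l : ℚ)) =
      ∑ T : Finset A.hyperplanes with
      (⨅ H ∈ T, LinearMap.ker (A.form H)) = ⨅ H, LinearMap.ker (A.form H),
      pathSeries A.signs T := by
    ext l
    rw [PowerSeries.coeff_mk, interiorEulerChar_eq_coeff]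
  rw [← hI, ← center_eq_iInf_ker, ← A.finrank_center_add_rank, Fintype.card_coe] at h
  change _ = _ * (PowerSeries.X ^ A.card * _) at h
  have hc : ∀ n : ℕ, ((-1 : ℚ⟦X⟧) ^ n) * (-1) ^ n = 1 := fun n => by
    rw [← mul_pow]
    simp
  calc (PowerSeries.mk fun l => (A.interiorEulerChar l : ℚ))
      = ((-1 : ℚ⟦X⟧) ^ A.rank * (-1) ^ A.rank) * ((-1) ^ Module.finrank ℝ A.center *
        (-1) ^ Module.finrank ℝ A.center) *
        (PowerSeries.mk fun l => (A.interiorEulerChar l : ℚ)) := by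
        rw [hc, hc, one_mul, one_mul]
    _ = (-1) ^ A.rank * ((-1) ^ Module.finrank ℝ A.center *
        ((-1) ^ (A.rank + Module.finrank ℝ A.center) *
          (PowerSeries.mk fun l => (A.interiorEulerChar l : ℚ)))) := by
        rw [pow_add]; ring
    _ = _ := by
        rw [h, ← mul_assoc ((-1 : ℚ⟦X⟧) ^ Module.finrank ℝ A.center), hc, one_mul]

/-- The negative of a chamber's covector is again a nowhere-zero covector, which supplies the
antipodes for `invertX_mag`. -/
theorem interiorMag_eq :
    A.interiorMag = (-1) ^ A.rank * (RatFunc.X ^ A.card * A.mag) := by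
  rw [interiorMag, ← invertX_apply, mag, invertX_mag A.signs_injective A.topeGraph_edist
    A.isChamberSystem.ne_zero fun C => ?_, Fintype.card_coe]
  · rfl
  · exact A.isChamberSystem.surj _ (A.isChamberSystem.isCovector C).neg fun H => by
      rw [Pi.neg_apply, Ne, SignType.neg_eq_zero_iff]
      exact A.isChamberSystem.ne_zero C H

end

end Arrangement

theorem corollary5 (d : ℕ) (A : Arrangement d) :
    (A.interiorMag : LaurentSeries ℚ) =
        ((PowerSeries.mk fun ℓ : ℕ => (A.interiorEulerChar ℓ : ℚ)) : LaurentSeries ℚ) ∧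
      (∀ ℓ : ℕ, A.interiorEulerChar (ℓ + A.card) = (-1) ^ A.rank * A.magEulerChar ℓ) ∧
      (∀ ℓ : ℕ, ℓ < A.card → A.interiorEulerChar ℓ = 0) := by
  classical
  have hcoeff : ∀ l : ℕ, (A.interiorEulerChar l : ℚ) = (-1) ^ A.rank *
      PowerSeries.coeff l (PowerSeries.X ^ A.card *
        ∑ T : Finset A.hyperplanes, SignVector.pathSeries A.signs T) := by
    intro l
    have h := congrArg (PowerSeries.coeff l) A.mk_interiorEulerChar
    rw [PowerSeries.coeff_mk] at h
    rw [h]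
    rcases Nat.even_or_odd A.rank with hr | hr
    · rw [hr.neg_one_pow, hr.neg_one_pow, one_mul, one_mul]
    · rw [hr.neg_one_pow, hr.neg_one_pow, neg_one_mul, neg_one_mul, map_neg]
  refine ⟨?_, fun l => ?_, fun l hl => ?_⟩
  -- Both sides are `(-1)^r q^n Mag`: the left by antipodal symmetry, the right by reciprocity.
  · change SignVector.ratFuncToLaurent ℚ A.interiorMag = _
    rw [A.interiorMag_eq, A.mk_interiorEulerChar, map_mul, map_mul, map_mul, map_mul, map_pow,
      map_pow, map_pow, map_pow, map_neg, map_neg, map_one, map_one,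
      SignVector.ratFuncToLaurent_X, Arrangement.mag,
      SignVector.ratFuncToLaurent_mag A.signs_injective A.topeGraph_edist]
  · have h := hcoeff (l + A.card)
    rw [PowerSeries.coeff_X_pow_mul, ← A.magEulerChar_eq_coeff] at h
    exact_mod_cast h
  · have h := hcoeff l
    rw [PowerSeries.coeff_X_pow_mul', if_neg (not_le.2 hl), mul_zero] at h
    exact_mod_cast h
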